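/- Work in ZFC; regular cardinals are infinite, and $H(\theta)$ is the set of all sets whose transitive closure has size less than $\theta$. A *weak $\kappa$-model* is a (not necessarily transitive) set $M$ of size $\kappa$ with $\kappa+1\subseteq M$ and $\langle M,\in\rangle\models\mathsf{ZFC}^-$, where $\mathsf{ZFC}^-$ is $\mathsf{ZFC}$ without the power set axiom and with the collection scheme in place of replacement (and choice as the well-ordering principle). An elementary embedding $j\colon M\to N$ is *$\kappa$-powerset preserving* if its critical point is $\kappa$ and $M$ and $N$ have the same subsets of $\kappa$. For regular cardinals $\alpha\le\kappa$, $\kappa$ is *$\alpha$-Ramsey* if for arbitrarily large regular cardinals $\theta$, every $A\subseteq\kappa$ is an element of some weak $\kappa$-model $M\prec H(\theta)$ which is closed under ${<}\alpha$-sequences and for which there exists a $\kappa$-powerset preserving elementary embedding $j\colon M\to N$ into a transitive set $N$. A cardinal $\kappa$ is *measurable* if it is uncountable and carries a nonprincipal ${<}\kappa$-complete ultrafilter. **Statement.** Let $\kappa$ be a measurable cardinal. Then $\kappa$ is a limit of regular cardinals $\alpha<\kappa$ which are $\alpha$-Ramsey; that is, for every cardinal $\beta<\kappa$ there is a regular cardinal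 $\alpha$ with $\beta<\alpha<\kappa$ such that $\alpha$ is $\alpha$-Ramsey. In particular, the top of the hierarchy lies strictly below measurability: $\kappa$ is itself $\kappa$-Ramsey, and there is a regular cardinal $\alpha<\kappa$ which is $\alpha$-Ramsey but not measurable. -/

import Mathlib

universe u

open scoped FirstOrder

namespace LargeCardinal

/-! ### First-order structures of sets -/

/-- The relation symbols of the language of set theory: one binary symbol. -/
inductive SetRel : ℕ → Type
  | mem : SetRel 2

/-- The first-order language of set theory. -/
def setLang : FirstOrder.Language.{0, 0} := ⟨fun _ => Empty, SetRel⟩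

/-- A class `S` of sets is regarded as the structure `⟨S, ∈⟩`. -/
instance memStructure (S : Set ZFSet.{u}) : setLang.Structure S where
  funMap := fun f => f.elim
  RelMap := fun r => match r with
    | SetRel.mem => fun x => (x 0 : ZFSet.{u}) ∈ (x 1 : ZFSet.{u})

/-- `IsElementarySubmodel M K` means that `⟨M, ∈⟩` is an elementary substructure of `⟨K, ∈⟩`. -/
def IsElementarySubmodel (M K : Set ZFSet.{u}) : Prop :=
  ∃ h : M ⊆ K, ∀ ⦃n : ℕ⦄ (φ : setLang.Formula (Fin n)) (x : Fin n → M),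
    φ.Realize (Set.inclusion h ∘ x) ↔ φ.Realize x

/-! ### The theory `ZFC⁻` -/

/-- `⟨S, ∈⟩` believes that `p` is the Kuratowski pair `(x, y) = {{x}, {x, y}}`. -/
def IsPairIn (S : Set ZFSet.{u}) (p x y : S) : Prop :=
  ∀ z : S, z.1 ∈ p.1 ↔
    (∀ t : S, t.1 ∈ z.1 ↔ t = x) ∨ (∀ t : S, t.1 ∈ z.1 ↔ t = x ∨ t = y)

/-- `⟨S, ∈⟩` is a model of `ZFC⁻`, that is `ZFC` without the power set axiom, with the collection
scheme in place of replacement and with choice in the form of the well-ordering principle.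
All quantifiers range over `S`, which need not be transitive; the two schemes range over all
first-order formulas, with parameters from `S`. -/
structure ModelsZFCMinus (S : Set ZFSet.{u}) : Prop where
  extensionality : ∀ a b : S, (∀ x : S, x.1 ∈ a.1 ↔ x.1 ∈ b.1) → a = b
  foundation : ∀ a : S, (∃ x : S, x.1 ∈ a.1) →
    ∃ x : S, x.1 ∈ a.1 ∧ ∀ y : S, y.1 ∈ x.1 → y.1 ∉ a.1
  pairing : ∀ a b : S, ∃ c : S, ∀ x : S, x.1 ∈ c.1 ↔ x = a ∨ x = b
  union : ∀ a : S, ∃ b : S, ∀ x : S, x.1 ∈ b.1 ↔ ∃ y : S, y.1 ∈ a.1 ∧ x.1 ∈ y.1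
  infinity : ∃ w : S, (∃ e : S, e.1 ∈ w.1 ∧ ∀ x : S, x.1 ∉ e.1) ∧
    ∀ x : S, x.1 ∈ w.1 → ∃ y : S, y.1 ∈ w.1 ∧ ∀ z : S, z.1 ∈ y.1 ↔ z.1 ∈ x.1 ∨ z = x
  separation : ∀ (n : ℕ) (φ : setLang.Formula (Fin (n + 1))) (p : Fin n → S) (a : S),
    ∃ b : S, ∀ x : S, x.1 ∈ b.1 ↔ x.1 ∈ a.1 ∧ φ.Realize (Fin.cons x p : Fin (n + 1) → S)
  collection : ∀ (n : ℕ) (φ : setLang.Formula (Fin (n + 2))) (p : Fin n → S) (a : S),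
    (∀ x : S, x.1 ∈ a.1 →
      ∃ y : S, φ.Realize (Fin.cons x (Fin.cons y p : Fin (n + 1) → S) : Fin (n + 2) → S)) →
    ∃ b : S, ∀ x : S, x.1 ∈ a.1 → ∃ y : S, y.1 ∈ b.1 ∧
      φ.Realize (Fin.cons x (Fin.cons y p : Fin (n + 1) → S) : Fin (n + 2) → S)
  /-- Every set `a` carries a linear order `r` for which every nonempty subset of `a` has a
  least element. -/
  wellOrdering : ∀ a : S, ∃ r : S,
    (∀ x y : S, x.1 ∈ a.1 → y.1 ∈ a.1 →
      (∃ p : S, p.1 ∈ r.1 ∧ IsPairIn S p x y) →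
      (∃ p : S, p.1 ∈ r.1 ∧ IsPairIn S p y x) → x = y) ∧
    (∀ x y z : S, x.1 ∈ a.1 → y.1 ∈ a.1 → z.1 ∈ a.1 →
      (∃ p : S, p.1 ∈ r.1 ∧ IsPairIn S p x y) →
      (∃ p : S, p.1 ∈ r.1 ∧ IsPairIn S p y z) →
      ∃ p : S, p.1 ∈ r.1 ∧ IsPairIn S p x z) ∧
    (∀ b : S, (∀ x : S, x.1 ∈ b.1 → x.1 ∈ a.1) → (∃ x : S, x.1 ∈ b.1) →
      ∃ x : S, x.1 ∈ b.1 ∧ ∀ y : S, y.1 ∈ b.1 →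
        ∃ p : S, p.1 ∈ r.1 ∧ IsPairIn S p x y)

/-! ### Weak `κ`-models and `α`-Ramsey cardinals

The cardinal `κ` is identified, as a set, with the von Neumann ordinal `κ.ord.toZFSet`. -/

/-- `H(θ)`, the class of all sets whose transitive closure has size less than `θ`,
that is, which are included in a transitive set of size less than `θ`. -/
def H (θ : Cardinal.{u}) : Set ZFSet.{u} :=
  {x | ∃ t : ZFSet.{u}, t.IsTransitive ∧ x ⊆ t ∧ t.card < θ}

/-- A weak `κ`-model: a (not necessarily transitive) set `M` of size `κ` such that
`κ + 1 ⊆ M` and `⟨M, ∈⟩` is a model of `ZFC⁻`. -/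
structure IsWeakModel (κ : Cardinal.{u}) (M : ZFSet.{u}) : Prop where
  card_eq : M.card = κ
  succ_subset : (κ.ord + 1).toZFSet ⊆ M
  models : ModelsZFCMinus (M : Set ZFSet.{u})

/-- `M` is closed under `<α`-sequences: every function from an ordinal `β < α` to `M`
is an element of `M`. -/
def ClosedUnderSeq (α : Cardinal.{u}) (M : ZFSet.{u}) : Prop :=
  ∀ β < α.ord, ∀ f : ZFSet.{u}, ZFSet.IsFunc β.toZFSet M f → f ∈ M

/-- The elementary embedding `j : M → N` is `κ`-powerset preserving: its critical point (the least
ordinal that it moves) is `κ`, and `M` and `N` have the same subsets of `κ`. -/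
def IsPowersetPreserving (κ : Cardinal.{u}) {M N : ZFSet.{u}}
    (j : (M : Set ZFSet.{u}) ↪ₑ[setLang] (N : Set ZFSet.{u})) : Prop :=
  (∀ x : (M : Set ZFSet.{u}), x.1 ∈ κ.ord.toZFSet → (j x).1 = x.1) ∧
  (∃ k : (M : Set ZFSet.{u}), k.1 = κ.ord.toZFSet ∧ (j k).1 ≠ k.1) ∧
  ∀ X : ZFSet.{u}, X ⊆ κ.ord.toZFSet → (X ∈ M ↔ X ∈ N)

/-- `IsRamsey α κ` means that `α ≤ κ` are regular cardinals and that `κ` is `α`-Ramsey: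
for arbitrarily large regular cardinals `θ`, every `A ⊆ κ` is an element of some weak `κ`-model
`M ≺ H(θ)` which is closed under `<α`-sequences and for which there is a `κ`-powerset preserving
elementary embedding `j : M → N` into a transitive set `N`. -/
def IsRamsey (α κ : Cardinal.{u}) : Prop :=
  α ≤ κ ∧ α.IsRegular ∧ κ.IsRegular ∧
  ∀ μ : Cardinal.{u}, ∃ θ : Cardinal.{u}, μ ≤ θ ∧ θ.IsRegular ∧
    ∀ A : ZFSet.{u}, A ⊆ κ.ord.toZFSet →
      ∃ M : ZFSet.{u}, A ∈ M ∧ IsWeakModel κ M ∧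
        IsElementarySubmodel (M : Set ZFSet.{u}) (H θ) ∧ ClosedUnderSeq α M ∧
        ∃ N : ZFSet.{u}, N.IsTransitive ∧
          ∃ j : (M : Set ZFSet.{u}) ↪ₑ[setLang] (N : Set ZFSet.{u}), IsPowersetPreserving κ j

/-! ### Measurable cardinals -/

/-- `κ` is measurable: it is uncountable and there is a nonprincipal `<κ`-complete ultrafilter
on `κ`. -/
def IsMeasurable (κ : Cardinal.{u}) : Prop :=
  Cardinal.aleph0 < κ ∧ ∃ U : Ultrafilter κ.ord.ToType,
    (∀ x : κ.ord.ToType, ({x} : Set κ.ord.ToType) ∉ U) ∧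
    CardinalInterFilter (U : Filter κ.ord.ToType) κ

end LargeCardinal

/-!
Let `U` be a normal measure on `κ`, and let `f k`, `k < κ`, enumerate a family of functions into
`H(θ)` which is closed under pointwise Skolem functions and `<κ`-sequences. Reducing the functions
`y ↦ f k (a, y)` modulo `U` gives, for every subfamily, a well-founded structure which satisfies
Łoś's theorem and hence has a transitive collapse.

For `κ` itself take for `M` the values of the functions at one point, and for `N` the collapse; `j`
sends a value to the class of the corresponding constant function. For the second part, take for
`U`-almost every `a < κ` the values `f k (a, a)` with `k < a` for `M`, and for `N` the collapse of
the functions `y ↦ f k (a, y)` with `k < a`; now `j` sends `f k (a, a)` to the class of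
`y ↦ f k (y, y)`. By normality the relevant closure properties of the family restrict to the indices
`k < a` for almost every `a`, and since `U` is `κ`-complete it serves for all these `a` at once.
That `N` has no subsets of `a` outside `M` holds because the family contains, with every `f`, the
function tracing its classes modulo `U` on `a`.

If every `α`-Ramsey `α < κ` were measurable, the least measurable cardinal would have such an `α`
below it.
-/

universe v w

namespace LargeCardinal

open Cardinal Set Filter
open FirstOrder.Language (BoundedFormula Formula)

/-! ### First-order relations and elementary equivalence -/

/-- A relation on tuples, given uniformly for all structures `⟨S, ∈⟩`, is first-order if a single
formula of set theory defines it in all of them. -/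
def IsFirstOrder {α : Type} (R : ∀ S : Set ZFSet.{u}, (α → S) → Prop) : Prop :=
  ∃ φ : setLang.Formula α, ∀ (S : Set ZFSet.{u}) (v : α → S), φ.Realize v ↔ R S v

namespace IsFirstOrder

variable {α : Type} {P Q : ∀ S : Set ZFSet.{u}, (α → S) → Prop}

theorem mem (a b : α) : IsFirstOrder.{u} fun _ v => (v a).1 ∈ (v b).1 :=
  ⟨FirstOrder.Language.Relations.formula₂ (L := setLang) (SetRel.mem : setLang.Relations 2)
    (.var a) (.var b), fun _ _ => Iff.rfl⟩

theorem eq (a b : α) : IsFirstOrder.{u} fun _ v => v a = v b :=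
  ⟨FirstOrder.Language.Term.equal (.var a) (.var b), fun _ _ => Formula.realize_equal⟩

theorem realize_cons {n : ℕ} (φ : setLang.Formula (Fin (n + 1))) (a : α) (f : Fin n → α) :
    IsFirstOrder.{u} fun _ v => φ.Realize (Fin.cons (v a) fun i => v (f i)) :=
  ⟨φ.relabel (Fin.cons a f), fun _ _ => by
    rw [Formula.realize_relabel, Fin.comp_cons]; rfl⟩

theorem realize_cons_cons {n : ℕ} (φ : setLang.Formula (Fin (n + 2))) (a b : α) (f : Fin n → α) :
    IsFirstOrder.{u} fun _ v => φ.Realize (Fin.cons (v a) (Fin.cons (v b) fun i => v (f i))) :=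
  ⟨φ.relabel (Fin.cons a (Fin.cons b f)), fun _ _ => by
    rw [Formula.realize_relabel, Fin.comp_cons, Fin.comp_cons]; rfl⟩

theorem not (h : IsFirstOrder P) : IsFirstOrder fun S v => ¬ P S v := by
  obtain ⟨φ, hφ⟩ := h
  exact ⟨φ.not, fun S v => by rw [Formula.realize_not, hφ]⟩

theorem imp (hP : IsFirstOrder P) (hQ : IsFirstOrder Q) :
    IsFirstOrder fun S v => P S v → Q S v := by
  obtain ⟨φ, hφ⟩ := hP
  obtain ⟨ψ, hψ⟩ := hQ
  exact ⟨φ.imp ψ, fun S v => by rw [Formula.realize_imp, hφ, hψ]⟩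

theorem congr (h : IsFirstOrder P) (hPQ : ∀ S v, P S v ↔ Q S v) : IsFirstOrder Q := by
  obtain ⟨φ, hφ⟩ := h
  exact ⟨φ, fun S v => (hφ S v).trans (hPQ S v)⟩

theorem or (hP : IsFirstOrder P) (hQ : IsFirstOrder Q) : IsFirstOrder fun S v => P S v ∨ Q S v :=
  (hP.not.imp hQ).congr fun _ _ => or_iff_not_imp_left.symm

theorem and (hP : IsFirstOrder P) (hQ : IsFirstOrder Q) : IsFirstOrder fun S v => P S v ∧ Q S v :=
  (hP.imp hQ.not).not.congr fun _ _ => by rw [Classical.not_imp, not_not]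

theorem iff (hP : IsFirstOrder P) (hQ : IsFirstOrder Q) :
    IsFirstOrder fun S v => P S v ↔ Q S v :=
  ((hP.imp hQ).and (hQ.imp hP)).congr fun _ _ => iff_def.symm

theorem allTuple {β : Type} [Finite β] {R : ∀ S : Set ZFSet.{u}, (α → S) → (β → S) → Prop}
    (h : IsFirstOrder fun S (w : α ⊕ β → S) => R S (w ∘ Sum.inl) (w ∘ Sum.inr)) :
    IsFirstOrder fun S v => ∀ p, R S v p := by
  obtain ⟨φ, hφ⟩ := h
  exact ⟨φ.iAlls β, fun S v => Formula.realize_iAlls.trans (forall_congr' fun p => hφ S _)⟩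

variable {R : ∀ S : Set ZFSet.{u}, (α → S) → S → Prop}

theorem all (h : IsFirstOrder fun S (w : α ⊕ Unit → S) => R S (w ∘ Sum.inl) (w (.inr ()))) :
    IsFirstOrder fun S v => ∀ x, R S v x :=
  (allTuple (R := fun S v p => R S v (p ())) h).congr fun _ _ =>
    ⟨fun h x => h fun _ => x, fun h p => h (p ())⟩

theorem ex (h : IsFirstOrder fun S (w : α ⊕ Unit → S) => R S (w ∘ Sum.inl) (w (.inr ()))) :
    IsFirstOrder fun S v => ∃ x, R S v x :=
  (all (R := fun S v x => ¬ R S v x) h.not).not.congr fun _ _ => not_forall_not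

theorem isPairIn (p a b : α) : IsFirstOrder.{u} fun S v => IsPairIn S (v p) (v a) (v b) :=
  .all <| .iff (.mem _ _) <|
    .or (.all <| .iff (.mem _ _) (.eq _ _)) (.all <| .iff (.mem _ _) (.or (.eq _ _) (.eq _ _)))

theorem related (r a b : α) : IsFirstOrder.{u} fun S v =>
    ∃ p : S, p.1 ∈ (v r).1 ∧ IsPairIn S p (v a) (v b) :=
  .ex <| .and (.mem _ _) (.isPairIn _ _ _)

@[elab_as_elim]
theorem transfer {P : Set ZFSet.{u} → Prop} {S T : Set ZFSet.{u}} (hST : S ≅[setLang] T)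
    (hS : P S) (h : IsFirstOrder fun S (_ : Empty → S) => P S) : P T := by
  obtain ⟨φ, hφ⟩ := h
  exact (hφ T default).1 ((hST.realize_sentence φ).1 ((hφ S default).2 hS))

end IsFirstOrder

theorem ModelsZFCMinus.of_elementarilyEquivalent {S T : Set ZFSet.{u}} (hS : ModelsZFCMinus S)
    (hST : S ≅[setLang] T) : ModelsZFCMinus T where
  extensionality := IsFirstOrder.transfer hST hS.extensionality <|
    .all <| .all <| .imp (.all <| .iff (.mem _ _) (.mem _ _)) (.eq _ _)
  foundation := IsFirstOrder.transfer hST hS.foundation <|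
    .all <| .imp (.ex <| .mem _ _) <| .ex <| .and (.mem _ _) <| .all <|
      .imp (.mem _ _) (.not <| .mem _ _)
  pairing := IsFirstOrder.transfer hST hS.pairing <|
    .all <| .all <| .ex <| .all <| .iff (.mem _ _) (.or (.eq _ _) (.eq _ _))
  union := IsFirstOrder.transfer hST hS.union <|
    .all <| .ex <| .all <| .iff (.mem _ _) (.ex <| .and (.mem _ _) (.mem _ _))
  infinity := IsFirstOrder.transfer hST hS.infinity <|
    .ex <| .and (.ex <| .and (.mem _ _) <| .all <| .not <| .mem _ _) <|
      .all <| .imp (.mem _ _) <| .ex <| .and (.mem _ _) <|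
        .all <| .iff (.mem _ _) (.or (.mem _ _) (.eq _ _))
  separation n φ := IsFirstOrder.transfer hST (hS.separation n φ) <|
    .allTuple <| .all <| .ex <| .all <| .iff (.mem _ _) (.and (.mem _ _) <| .realize_cons φ _ _)
  collection n φ := IsFirstOrder.transfer hST (hS.collection n φ) <|
    .allTuple <| .all <| .imp (.all <| .imp (.mem _ _) <| .ex <| .realize_cons_cons φ _ _ _ ) <|
      .ex <| .all <| .imp (.mem _ _) <| .ex <| .and (.mem _ _) <| .realize_cons_cons φ _ _ _
  wellOrdering := IsFirstOrder.transfer hST hS.wellOrdering <|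
    .all <| .ex <| .and
      (.all <| .all <| .imp (.mem _ _) <| .imp (.mem _ _) <|
        .imp (.related _ _ _) <| .imp (.related _ _ _) (.eq _ _)) <| .and
      (.all <| .all <| .all <| .imp (.mem _ _) <| .imp (.mem _ _) <| .imp (.mem _ _) <|
        .imp (.related _ _ _) <| .imp (.related _ _ _) (.related _ _ _)) <|
      .all <| .imp (.all <| .imp (.mem _ _) (.mem _ _)) <| .imp (.ex <| .mem _ _) <|
        .ex <| .and (.mem _ _) <| .all <| .imp (.mem _ _) (.related _ _ _)

theorem IsElementarySubmodel.elementarilyEquivalent {M K : Set ZFSet.{u}}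
    (h : IsElementarySubmodel M K) : M ≅[setLang] K :=
  FirstOrder.Language.ElementaryEmbedding.elementarilyEquivalent ⟨inclusion h.1, h.2⟩

/-! ### The structure `H(θ)` -/

theorem card_range_le {α : Type u} (f : α → ZFSet.{u}) : (ZFSet.range f).card ≤ #α := by
  simpa using ZFSet.lift_card_range_le (f := f)

theorem isPairIn_iff {S : Set ZFSet.{u}} (trans : ∀ x ∈ S, ∀ y ∈ x, y ∈ S)
    (insert_singleton : ∀ x ∈ S, ∀ y ∈ S, ({x, y} : ZFSet) ∈ S) {p x y : S} :
    IsPairIn S p x y ↔ p.1 = ZFSet.pair x.1 y.1 := by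
  have ext {a b : ZFSet} (ha : a ∈ S) (hb : b ∈ S) : a = b ↔ ∀ t : S, t.1 ∈ a ↔ t.1 ∈ b := by
    refine ⟨fun h t => by rw [h], fun h => ZFSet.ext fun z => ⟨fun hz => ?_, fun hz => ?_⟩⟩
    · exact (h ⟨z, trans a ha z hz⟩).1 hz
    · exact (h ⟨z, trans b hb z hz⟩).2 hz
  have singleton {x : ZFSet} (hx : x ∈ S) : {x} ∈ S := by
    simpa only [ZFSet.pair_eq_singleton] using insert_singleton x hx x hx
  have pair_mem : ZFSet.pair x.1 y.1 ∈ S :=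
    insert_singleton _ (singleton x.2) _ (insert_singleton _ x.2 _ y.2)
  rw [ext p.2 pair_mem]
  refine forall_congr' fun z => iff_congr Iff.rfl ?_
  rw [ZFSet.pair, ZFSet.mem_pair, ext z.2 (singleton x.2), ext z.2 (insert_singleton _ x.2 _ y.2)]
  simp only [ZFSet.mem_singleton, ZFSet.mem_pair, Subtype.ext_iff]

section H

variable {θ : Cardinal.{u}} {x y : ZFSet.{u}}

theorem mem_H_of_mem (hx : x ∈ H θ) (hy : y ∈ x) : y ∈ H θ := by
  obtain ⟨t, ht, hxt, hc⟩ := hx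
  exact ⟨t, ht, ht y (hxt hy), hc⟩

theorem mem_H_of_subset (hx : x ∈ H θ) (hy : y ⊆ x) : y ∈ H θ := by
  obtain ⟨t, ht, hxt, hc⟩ := hx
  exact ⟨t, ht, fun z hz => hxt (hy hz), hc⟩

theorem sUnion_mem_H (hx : x ∈ H θ) : ZFSet.sUnion x ∈ H θ := by
  obtain ⟨t, ht, hxt, hc⟩ := hx
  refine ⟨t, ht, fun z hz => ?_, hc⟩
  obtain ⟨y, hy, hzy⟩ := ZFSet.mem_sUnion.1 hz
  exact ht y (hxt hy) hzy

theorem card_lt_of_mem_H (hx : x ∈ H θ) : x.card < θ := by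
  obtain ⟨t, -, hxt, hc⟩ := hx
  exact (ZFSet.card_mono hxt).trans_lt hc

theorem toZFSet_mem_H {o : Ordinal.{u}} (ho : o.card < θ) : o.toZFSet ∈ H θ :=
  ⟨_, (ZFSet.isOrdinal_toZFSet o).isTransitive, fun _ h => h, by simpa using ho⟩

theorem range_mem_H (hθ : θ.IsRegular) {α : Type u} (hα : #α < θ) {f : α → ZFSet.{u}}
    (hf : ∀ a, f a ∈ H θ) : ZFSet.range f ∈ H θ := by
  choose t ht hft hc using hf
  refine ⟨ZFSet.range f ∪ ZFSet.iUnion t, fun y hy z hz => ?_,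
    fun z hz => ZFSet.mem_union.2 (.inl hz), ?_⟩
  · refine ZFSet.mem_union.2 (.inr (ZFSet.mem_iUnion.2 ?_))
    rcases ZFSet.mem_union.1 hy with hy | hy
    · obtain ⟨a, rfl⟩ := ZFSet.mem_range.1 hy
      exact ⟨a, hft a hz⟩
    · obtain ⟨a, ha⟩ := ZFSet.mem_iUnion.1 hy
      exact ⟨a, ht a y ha hz⟩
  · have hunion : (ZFSet.iUnion t).card ≤ Cardinal.sum fun a => (t a).card := by
      simpa only [lift_id] using ZFSet.lift_card_iUnion_le_sum_card (f := t)
    exact ZFSet.card_union_le.trans_lt (add_lt_of_lt hθ.aleph0_le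
      ((card_range_le f).trans_lt hα) (hunion.trans_lt (sum_lt_of_isRegular hθ hα hc)))

theorem insert_singleton_mem_H (hθ : θ.IsRegular) (hx : x ∈ H θ) (hy : y ∈ H θ) :
    ({x, y} : ZFSet) ∈ H θ := by
  have : ({x, y} : ZFSet) = ZFSet.range fun b : ULift.{u} Bool => if b.down then x else y := by
    ext z
    simp only [ZFSet.mem_pair, ZFSet.mem_range, ULift.exists, Bool.exists_bool]
    simp [eq_comm (a := z), or_comm]
  rw [this]
  exact range_mem_H hθ (by simpa using hθ.nat_lt 2) fun a => by split_ifs <;> assumption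

theorem pair_mem_H (hθ : θ.IsRegular) (hx : x ∈ H θ) (hy : y ∈ H θ) : ZFSet.pair x y ∈ H θ := by
  refine insert_singleton_mem_H hθ ?_ (insert_singleton_mem_H hθ hx hy)
  simpa only [ZFSet.pair_eq_singleton] using insert_singleton_mem_H hθ hx hx

theorem exists_range_eq_of_card_lt {c : Cardinal.{u}} (hx : x.card < c) :
    ∃ (α : Type u) (f : α → ZFSet.{u}), #α < c ∧ ZFSet.range f = x :=
  ⟨Shrink x, fun i => ((equivShrink x).symm i).1, hx, by
    ext z
    simp [ZFSet.mem_range, (equivShrink x).symm.exists_congr_left]⟩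

theorem prod_mem_H (hθ : θ.IsRegular) (hx : x ∈ H θ) (hy : y ∈ H θ) : x.prod y ∈ H θ := by
  obtain ⟨α, f, hα, rfl⟩ := exists_range_eq_of_card_lt (card_lt_of_mem_H hx)
  obtain ⟨β, g, hβ, rfl⟩ := exists_range_eq_of_card_lt (card_lt_of_mem_H hy)
  have : (ZFSet.range f).prod (ZFSet.range g) =
      ZFSet.range fun p : α × β => ZFSet.pair (f p.1) (g p.2) := by
    ext z
    simp only [ZFSet.mem_prod, ZFSet.mem_range, Prod.exists]
    grind
  rw [this]
  exact range_mem_H hθ (by simpa using mul_lt_of_lt hθ.aleph0_le hα hβ) fun p =>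
    pair_mem_H hθ (mem_H_of_mem hx (ZFSet.mem_range_self _))
      (mem_H_of_mem hy (ZFSet.mem_range_self _))

theorem exists_wellOrder_H (hθ : θ.IsRegular) (a : H θ) :
    ∃ r : H θ, ∀ x y : H θ, (∃ p : H θ, p.1 ∈ r.1 ∧ IsPairIn (H θ) p x y) ↔
      x.1 ∈ a.1 ∧ y.1 ∈ a.1 ∧ ¬ WellOrderingRel y.1 x.1 := by
  let r := ZFSet.sep (fun p => ∃ x y, p = ZFSet.pair x y ∧ ¬ WellOrderingRel y x) (a.1.prod a.1)
  have hr (x y) : ZFSet.pair x y ∈ r ↔ x ∈ a.1 ∧ y ∈ a.1 ∧ ¬ WellOrderingRel y x := by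
    simp only [r, ZFSet.mem_sep, ZFSet.pair_mem_prod, ZFSet.pair_inj, and_assoc]
    grind
  refine ⟨⟨r, mem_H_of_subset (prod_mem_H hθ a.2 a.2) ZFSet.sep_subset⟩, fun x y => ?_⟩
  simp only [← hr, isPairIn_iff (fun _ hx _ hy => mem_H_of_mem hx hy)
    fun _ hx _ hy => insert_singleton_mem_H hθ hx hy]
  exact ⟨fun ⟨_, hp, hpair⟩ => hpair ▸ hp, fun h => ⟨⟨_, pair_mem_H hθ x.2 y.2⟩, h, rfl⟩⟩

theorem separation_H (hx : x ∈ H θ) (p : H θ → Prop) :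
    ∃ b : H θ, ∀ z : H θ, z.1 ∈ b.1 ↔ z.1 ∈ x ∧ p z :=
  ⟨⟨_, mem_H_of_subset hx (ZFSet.sep_subset (p := fun z => ∃ h : z ∈ H θ, p ⟨z, h⟩))⟩,
    fun z => by simp⟩

theorem collection_H (hθ : θ.IsRegular) (hx : x ∈ H θ) {r : H θ → H θ → Prop}
    (h : ∀ z : H θ, z.1 ∈ x → ∃ y, r z y) :
    ∃ b : H θ, ∀ z : H θ, z.1 ∈ x → ∃ y : H θ, y.1 ∈ b.1 ∧ r z y := by
  obtain ⟨α, f, hα, rfl⟩ := exists_range_eq_of_card_lt (card_lt_of_mem_H hx)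
  have hf (a) : f a ∈ H θ := mem_H_of_mem hx (ZFSet.mem_range_self a)
  choose g hg using fun a => h ⟨f a, hf a⟩ (ZFSet.mem_range_self a)
  refine ⟨⟨_, range_mem_H hθ hα fun a => (g a).2⟩, fun z hz => ?_⟩
  obtain ⟨a, ha⟩ := ZFSet.mem_range.1 hz
  obtain rfl : ⟨f a, hf a⟩ = z := Subtype.ext ha
  exact ⟨g a, ZFSet.mem_range_self a, hg a⟩

theorem infinity_H (hω : ℵ₀ < θ) :
    ∃ w : H θ, (∃ e : H θ, e.1 ∈ w.1 ∧ ∀ x : H θ, x.1 ∉ e.1) ∧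
      ∀ x : H θ, x.1 ∈ w.1 → ∃ y : H θ, y.1 ∈ w.1 ∧ ∀ z : H θ, z.1 ∈ y.1 ↔ z.1 ∈ x.1 ∨ z = x := by
  have hωH : Ordinal.omega0.toZFSet ∈ H θ := toZFSet_mem_H (by simpa using hω)
  refine ⟨⟨_, hωH⟩, ⟨⟨_, mem_H_of_mem hωH (Ordinal.toZFSet_mem_toZFSet_iff.2
    Ordinal.omega0_pos)⟩, Ordinal.toZFSet_mem_toZFSet_iff.2 Ordinal.omega0_pos, by simp⟩, ?_⟩
  rintro ⟨x, _⟩ hx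
  obtain ⟨o, ho, rfl⟩ := Ordinal.mem_toZFSet_iff.1 hx
  have hsucc : (o + 1).toZFSet ∈ Ordinal.omega0.toZFSet :=
    Ordinal.toZFSet_mem_toZFSet_iff.2 (Ordinal.isSuccLimit_omega0.succ_lt ho)
  exact ⟨⟨_, mem_H_of_mem hωH hsucc⟩, hsucc, fun z => by
    simp only [Ordinal.toZFSet_add_one, ZFSet.mem_insert_iff, Subtype.ext_iff, or_comm]⟩

theorem modelsZFCMinus_H (hθ : θ.IsRegular) (hω : ℵ₀ < θ) : ModelsZFCMinus (H θ) where
  extensionality a b h := Subtype.ext <| ZFSet.ext fun z =>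
    ⟨fun hz => (h ⟨z, mem_H_of_mem a.2 hz⟩).1 hz, fun hz => (h ⟨z, mem_H_of_mem b.2 hz⟩).2 hz⟩
  foundation := by
    rintro a ⟨x, hx⟩
    obtain ⟨y, hy, hmin⟩ := ZFSet.mem_wf.has_min {y | y ∈ a.1} ⟨x.1, hx⟩
    exact ⟨⟨y, mem_H_of_mem a.2 hy⟩, hy, fun z hz hza => hmin z.1 hza hz⟩
  pairing a b := ⟨⟨_, insert_singleton_mem_H hθ a.2 b.2⟩, fun x => by
    simp only [ZFSet.mem_pair, Subtype.ext_iff]⟩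
  union a := ⟨⟨_, sUnion_mem_H a.2⟩, fun x => by
    simp only [ZFSet.mem_sUnion]
    exact ⟨fun ⟨y, hy, hxy⟩ => ⟨⟨y, mem_H_of_mem a.2 hy⟩, hy, hxy⟩, fun ⟨y, hy⟩ => ⟨y.1, hy⟩⟩⟩
  infinity := infinity_H hω
  separation n φ p a := separation_H a.2 _
  collection n φ p a h := collection_H hθ a.2 h
  wellOrdering a := by
    obtain ⟨r, hr⟩ := exists_wellOrder_H hθ a
    refine ⟨r, ?_⟩
    simp only [hr]
    refine ⟨fun x y _ _ h1 h2 => ?_, fun x y z hx _ hz h1 h2 => ⟨hx, hz, fun h => ?_⟩,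
      fun b hb ⟨x, hx⟩ => ?_⟩
    · exact Subtype.ext (Std.Trichotomous.trichotomous (r := WellOrderingRel) _ _ h2.2.2 h1.2.2)
    · rcases trichotomous_of WellOrderingRel x.1 y.1 with h' | h' | h'
      · exact h2.2.2 (_root_.trans h h')
      · exact h2.2.2 (h' ▸ h)
      · exact h1.2.2 h'
    · obtain ⟨y, hy, hmin⟩ := (IsWellFounded.wf (r := WellOrderingRel (α := ZFSet.{u}))).has_min
        {y | y ∈ b.1} ⟨x.1, hx⟩
      have hyH := mem_H_of_mem b.2 hy
      exact ⟨⟨y, hyH⟩, hy, fun z hz => ⟨hb ⟨y, hyH⟩ hy, hb z hz, hmin z.1 hz⟩⟩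

end H

/-! ### Skolem closed families and their collapses -/

theorem exists_mostowskiCollapse {X : Type u} {E : X → X → Prop} (wf : WellFounded E)
    (congr : ∀ x y z, (∀ t, E t x ↔ E t y) → E x z → E y z) :
    ∃ N : ZFSet.{u}, N.IsTransitive ∧ ∃ π : X → (N : Set ZFSet.{u}), Function.Surjective π ∧
      (∀ x y, (π x).1 ∈ (π y).1 ↔ E x y) ∧ ∀ x y, π x = π y ↔ ∀ t, E t x ↔ E t y := by
  let p : X → ZFSet.{u} := wf.fix fun x f => ZFSet.range fun y : {y // E y x} => f y.1 y.2
  have mem_p {x z} : z ∈ p x ↔ ∃ y, E y x ∧ p y = z := by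
    have : p x = ZFSet.range fun y : {y // E y x} => p y.1 := wf.fix_eq _ x
    simp [this]
  have p_eq (x) : ∀ y, p x = p y → ∀ t, E t x ↔ E t y := by
    induction x using wf.induction with
    | _ x ih =>
    refine fun y hxy t => ⟨fun ht => ?_, fun ht => ?_⟩
    · obtain ⟨t', ht', h⟩ := mem_p.1 (hxy ▸ mem_p.2 ⟨t, ht, rfl⟩)
      exact congr t' t y (fun s => (ih t ht t' h.symm s).symm) ht'
    · obtain ⟨t', ht', h⟩ := mem_p.1 (hxy ▸ mem_p.2 ⟨t, ht, rfl⟩)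
      exact congr t' t x (ih t' ht' t h) ht'
  refine ⟨ZFSet.range p, fun x hx z hz => ?_, fun x => ⟨p x, ZFSet.mem_range_self x⟩, ?_,
    fun x y => ⟨fun h => mem_p.1 h |>.elim ?_, fun h => mem_p.2 ⟨x, h, rfl⟩⟩,
    fun x y => ⟨fun h => p_eq x y (congrArg Subtype.val h), fun h => Subtype.ext ?_⟩⟩
  · obtain ⟨y, rfl⟩ := ZFSet.mem_range.1 hx
    obtain ⟨z', -, rfl⟩ := mem_p.1 hz
    exact ZFSet.mem_range_self z'
  · rintro ⟨z, hz⟩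
    exact (ZFSet.mem_range.1 hz).imp fun x hx => Subtype.ext hx
  · exact fun z ⟨hz, h⟩ => congr z x y (p_eq z x h) hz
  · ext z
    simp only [mem_p, h]

/-- A family `g` of functions from `I` to a structure `K` is Skolem closed if every existential
statement with parameters in the family has a witness in the family that works at every point of
`I` at which a witness exists. -/
def IsSkolemClosed (L : FirstOrder.Language.{0, 0}) {ι I K : Type*} [L.Structure K]
    (g : ι → I → K) : Prop :=
  ∀ (m n : ℕ) (φ : L.BoundedFormula (Fin m) (n + 1)) (s : Fin m → ι) (t : Fin n → ι), ∃ k, ∀ i,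
    (∃ y, φ.Realize (fun j => g (s j) i) (Fin.snoc (fun j => g (t j) i) y)) →
      φ.Realize (fun j => g (s j) i) (Fin.snoc (fun j => g (t j) i) (g k i))

namespace IsSkolemClosed

section

variable {L : FirstOrder.Language.{0, 0}} {ι I I' K N : Type*} [L.Structure K] [L.Structure N]
  {g : ι → I → K}

/-- A version of Łoś's theorem for reduced powers consisting only of the functions `g k`. -/
theorem realize_iff_eventually [L.IsRelational] (hg : IsSkolemClosed L g) {U : Ultrafilter I}
    {π : ι → N} (surj : Function.Surjective π)
    (eq : ∀ k l, π k = π l ↔ ∀ᶠ i in (U : Filter I), g k i = g l i)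
    (rel : ∀ (n : ℕ) (r : L.Relations n) (v : Fin n → ι),
      FirstOrder.Language.Structure.RelMap r (π ∘ v) ↔
        ∀ᶠ i in (U : Filter I), FirstOrder.Language.Structure.RelMap r fun j => g (v j) i)
    {m n : ℕ} (φ : L.BoundedFormula (Fin m) n) (s : Fin m → ι) (t : Fin n → ι) :
    φ.Realize (π ∘ s) (π ∘ t) ↔
      ∀ᶠ i in (U : Filter I), φ.Realize (fun j => g (s j) i) fun j => g (t j) i := by
  have term {n : ℕ} (τ : L.Term (Fin m ⊕ Fin n)) (t : Fin n → ι) : ∃ k,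
      τ.realize (Sum.elim (π ∘ s) (π ∘ t)) = π k ∧
        ∀ i, τ.realize (Sum.elim (fun j => g (s j) i) fun j => g (t j) i) = g k i := by
    match τ with
    | .var (.inl j) => exact ⟨s j, rfl, fun _ => rfl⟩
    | .var (.inr j) => exact ⟨t j, rfl, fun _ => rfl⟩
    | .func f _ => exact isEmptyElim f
  induction φ with
  | falsum => simp only [BoundedFormula.Realize, eventually_const]
  | equal τ₁ τ₂ =>
    obtain ⟨k, hk, hgk⟩ := term τ₁ t
    obtain ⟨l, hl, hgl⟩ := term τ₂ t
    simp only [BoundedFormula.Realize, hk, hgk, hl, hgl, eq]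
  | rel r τ =>
    choose k hk hgk using fun j => term (τ j) t
    simp only [BoundedFormula.Realize, hk, hgk]
    exact rel _ r k
  | imp φ ψ hφ hψ => simp only [BoundedFormula.Realize, hφ, hψ, Ultrafilter.eventually_imp]
  | all φ ih =>
    have snoc (k) : (φ.Realize (π ∘ s) (Fin.snoc (π ∘ t) (π k)) ↔ ∀ᶠ i in (U : Filter I),
        φ.Realize (fun j => g (s j) i) (Fin.snoc (fun j => g (t j) i) (g k i))) := by
      have hg (i) : (fun j => g (Fin.snoc (α := fun _ => ι) t k j) i) =
          Fin.snoc (fun j => g (t j) i) (g k i) := Fin.comp_snoc (fun l => g l i) t k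
      simpa only [Fin.comp_snoc, hg] using ih (Fin.snoc t k)
    simp only [BoundedFormula.realize_all, surj.forall, snoc]
    refine ⟨fun h => ?_, fun h k => h.mono fun i hi => hi _⟩
    obtain ⟨k, hk⟩ := hg _ _ φ.not s t
    refine (h k).mono fun i hi => ?_
    by_contra! hy
    exact hk i hy hi

theorem formula_realize_iff_eventually [L.IsRelational] (hg : IsSkolemClosed L g)
    {U : Ultrafilter I} {π : ι → N} (surj : Function.Surjective π)
    (eq : ∀ k l, π k = π l ↔ ∀ᶠ i in (U : Filter I), g k i = g l i)
    (rel : ∀ (n : ℕ) (r : L.Relations n) (v : Fin n → ι),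
      FirstOrder.Language.Structure.RelMap r (π ∘ v) ↔
        ∀ᶠ i in (U : Filter I), FirstOrder.Language.Structure.RelMap r fun j => g (v j) i)
    {n : ℕ} (φ : L.Formula (Fin n)) (s : Fin n → ι) :
    φ.Realize (π ∘ s) ↔ ∀ᶠ i in (U : Filter I), φ.Realize fun j => g (s j) i := by
  simpa only [Formula.Realize, Subsingleton.elim (_ : Fin 0 → _) default] using
    hg.realize_iff_eventually surj eq rel φ s default

theorem comp (hg : IsSkolemClosed L g) (r : I' → I) :
    IsSkolemClosed L fun k i => g k (r i) := fun m n φ s t =>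
  (hg m n φ s t).imp fun _ hk i => hk (r i)

end

instance : setLang.IsRelational := fun _ => inferInstanceAs (IsEmpty Empty)

variable {ι I : Type u} {S : Set ZFSet.{u}} {g : ι → I → S}

theorem isElementarySubmodel {e : ι → S} (he : IsSkolemClosed setLang fun k (_ : Unit) => e k) :
    IsElementarySubmodel (range fun k => (e k).1) S := by
  have hsub : range (fun k => (e k).1) ⊆ S := range_subset_iff.2 fun k => (e k).2
  refine ⟨hsub, fun n φ x => ?_⟩
  obtain ⟨s, rfl⟩ : ∃ s : Fin n → ι, (fun j => ⟨(e (s j)).1, s j, rfl⟩) = x := by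
    choose s hs using fun j => (x j).2
    exact ⟨s, funext fun j => Subtype.ext (hs j)⟩
  exact (he.formula_realize_iff_eventually (U := pure ())
    (π := fun k => (⟨(e k).1, k, rfl⟩ : range fun k => (e k).1))
    (fun ⟨_, k, hk⟩ => ⟨k, Subtype.ext hk⟩) (fun _ _ => by simp [Subtype.ext_iff])
    (fun n r v => by cases r; exact Iff.rfl) φ s).symm

theorem exists_mem_iff_mem_imp_eq (hg : IsSkolemClosed setLang g)
    (hS : ∀ a b : S, (∀ x : S, x.1 ∈ a.1 ↔ x.1 ∈ b.1) → a = b) (k l : ι) :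
    ∃ d, ∀ i, ((g d i).1 ∈ (g k i).1 ↔ (g d i).1 ∈ (g l i).1) → g k i = g l i := by
  obtain ⟨φ, hφ⟩ : IsFirstOrder.{u} fun S (v : Fin 2 ⊕ Fin 1 → S) =>
    ¬ ((v (.inr 0)).1 ∈ (v (.inl 0)).1 ↔ (v (.inr 0)).1 ∈ (v (.inl 1)).1) :=
      .not (.iff (.mem _ _) (.mem _ _))
  obtain ⟨d, hd⟩ := hg 2 0 (BoundedFormula.relabel (n := 1) (k := 0) id φ) ![k, l] ![]
  have hφ' (i) (y : S) : (BoundedFormula.relabel (n := 1) (k := 0) id φ).Realize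
      (fun j => g (![k, l] j) i) (Fin.snoc (fun j => g (![] j) i) y) ↔
        ¬ (y.1 ∈ (g k i).1 ↔ y.1 ∈ (g l i).1) := by
    refine Iff.trans ?_ (hφ S (Sum.elim (fun j => g (![k, l] j) i) fun _ => y))
    rw [BoundedFormula.realize_relabel, Formula.Realize]
    congr!
  refine ⟨d, fun i hi => hS _ _ fun y => ?_⟩
  by_contra hy
  exact (hφ' i _).1 (hd i ⟨y, (hφ' i y).2 hy⟩) hi

theorem exists_collapse (hg : IsSkolemClosed setLang g)
    (hS : ∀ a b : S, (∀ x : S, x.1 ∈ a.1 ↔ x.1 ∈ b.1) → a = b) (U : Ultrafilter I)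
    [CountableInterFilter (U : Filter I)] :
    ∃ N : ZFSet.{u}, N.IsTransitive ∧ ∃ π : ι → (N : Set ZFSet.{u}), Function.Surjective π ∧
      ∀ ⦃n : ℕ⦄ (φ : setLang.Formula (Fin n)) (s : Fin n → ι),
        φ.Realize (π ∘ s) ↔ ∀ᶠ i in (U : Filter I), φ.Realize fun j => g (s j) i := by
  let E (k l : ι) : Prop := ∀ᶠ i in (U : Filter I), (g k i).1 ∈ (g l i).1
  have wf : WellFounded E := by
    rw [wellFounded_iff_isEmpty_descending_chain]
    refine ⟨fun ⟨k, hk⟩ => ?_⟩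
    obtain ⟨i, hi⟩ := (eventually_countable_forall.2 hk).exists
    exact (wellFounded_iff_isEmpty_descending_chain.1 ZFSet.mem_wf).false
      ⟨fun n => (g (k n) i).1, hi⟩
  have eq_iff (k l) : (∀ d, E d k ↔ E d l) ↔ ∀ᶠ i in (U : Filter I), g k i = g l i := by
    refine ⟨fun h => ?_, fun h d => eventually_congr (h.mono fun i hi => by rw [hi])⟩
    obtain ⟨d, hd⟩ := hg.exists_mem_iff_mem_imp_eq hS k l
    refine Eventually.mono ?_ hd
    by_cases hdk : E d k
    · exact hdk.mp (((h d).1 hdk).mono fun i hl hk => iff_of_true hk hl)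
    · exact (Ultrafilter.eventually_not.2 hdk).mp ((Ultrafilter.eventually_not.2
        (mt (h d).2 hdk)).mono fun i hl hk => iff_of_false hk hl)
  obtain ⟨N, hN, π, surj, hmem, heq⟩ := exists_mostowskiCollapse wf fun x y z h hz =>
    hz.mp (((eq_iff x y).1 h).mono fun i hi hxz => hi ▸ hxz)
  refine ⟨N, hN, π, surj, fun n φ s => ?_⟩
  exact hg.formula_realize_iff_eventually surj (fun k l => (heq k l).trans (eq_iff k l))
    (fun n r v => by cases r; exact hmem (v 0) (v 1)) φ s

end IsSkolemClosed

/-! ### Ramsey systems -/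

theorem eventually_mem_iff_exists_eventually_eq {I : Type u} {U : Ultrafilter I}
    {κ : Cardinal.{u}} [CardinalInterFilter (U : Filter I) κ] {x : ZFSet.{u}} (hx : x.card < κ)
    (f : I → ZFSet.{u}) :
    (∀ᶠ i in (U : Filter I), f i ∈ x) ↔ ∃ y ∈ x, ∀ᶠ i in (U : Filter I), f i = y := by
  refine ⟨fun h => ?_, fun ⟨y, hy, h⟩ => h.mono fun i hi => hi ▸ hy⟩
  obtain ⟨α, p, hα, rfl⟩ := exists_range_eq_of_card_lt hx
  simp only [ZFSet.mem_range, exists_exists_eq_and] at h ⊢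
  by_contra! hne
  obtain ⟨i, ⟨a, ha⟩, hi⟩ := (h.and ((eventually_cardinal_forall hα).2 hne)).exists
  exact hi a ha.symm

theorem card_lt_of_mem_toZFSet_ord {κ : Cardinal.{u}} {x : ZFSet.{u}} (hx : x ∈ κ.ord.toZFSet) :
    x.card < κ := by
  obtain ⟨o, ho, rfl⟩ := Ordinal.mem_toZFSet_iff.1 hx
  rw [Ordinal.card_toZFSet]
  exact lt_ord.1 ho

theorem isPowersetPreserving_of_isTransitive {κ : Cardinal.{u}} {M N : ZFSet.{u}}
    (hN : N.IsTransitive) (hNZFC : ModelsZFCMinus (N : Set ZFSet.{u}))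
    (hκN : κ.ord.toZFSet ∈ N) (j : (M : Set ZFSet.{u}) ↪ₑ[setLang] (N : Set ZFSet.{u}))
    (fix : ∀ x, x.1 ∈ κ.ord.toZFSet → (j x).1 = x.1)
    (moved : ∃ k, k.1 = κ.ord.toZFSet ∧ (j k).1 ≠ k.1)
    (hκM : κ.ord.toZFSet ⊆ M) (hNM : ∀ X ∈ N, X ⊆ κ.ord.toZFSet → X ∈ M) :
    IsPowersetPreserving κ j := by
  refine ⟨fix, moved, fun X hX => ⟨fun hXM => ?_, fun hXN => hNM X hXN hX⟩⟩
  obtain ⟨φ, hφ⟩ : IsFirstOrder.{u} fun _ (v : Fin 2 → _) => (v 0).1 ∈ (v 1).1 := .mem 0 1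
  obtain ⟨Y, hY⟩ := hNZFC.separation 1 φ ![j ⟨X, hXM⟩] ⟨_, hκN⟩
  have mem_iff (x : ZFSet) (hx : x ∈ κ.ord.toZFSet) : x ∈ (j ⟨X, hXM⟩).1 ↔ x ∈ X := by
    have := (hφ _ _).symm.trans ((j.map_formula φ ![⟨x, hκM hx⟩, ⟨X, hXM⟩]).trans (hφ _ _))
    simpa [fix ⟨x, hκM hx⟩ hx] using this
  suffices X = Y from this ▸ Y.2
  refine ZFSet.ext fun x => ⟨?_, ?_⟩
  · intro hx
    exact (hY ⟨x, hN _ hκN (hX hx)⟩).2 ⟨hX hx, (hφ _ _).2 ((mem_iff x (hX hx)).2 hx)⟩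
  · intro hx
    obtain ⟨hxκ, hxj⟩ := (hY ⟨x, hN _ Y.2 hx⟩).1 hx
    exact (mem_iff x hxκ).1 ((hφ _ _).1 hxj)

theorem exists_elementaryEmbedding_of_realize_iff {L : FirstOrder.Language.{0, 0}} {ι A B : Type*}
    [L.Structure A] [L.Structure B] {e : ι → A} {p : ι → B} (surj : Function.Surjective e)
    (h : ∀ ⦃n : ℕ⦄ (φ : L.Formula (Fin n)) (s : Fin n → ι), φ.Realize (p ∘ s) ↔ φ.Realize (e ∘ s)) :
    ∃ j : A ↪ₑ[L] B, ∀ k, j (e k) = p k := by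
  refine ⟨⟨p ∘ Function.surjInv surj, fun n φ x => ?_⟩, fun k => ?_⟩
  · rw [Function.comp_assoc, h, ← Function.comp_assoc,
      (Function.rightInverse_surjInv surj).comp_eq_id, Function.id_comp]
  · have := h (FirstOrder.Language.Term.equal (.var 0) (.var 1)) ![Function.surjInv surj (e k), k]
    simp only [Formula.realize_equal] at this
    exact this.2 (Function.surjInv_eq surj (e k))

theorem mem_iff_of_realize_iff_eventually {S N : Set ZFSet.{u}} {ι I : Type*} {g : ι → I → S}
    {F : Filter I} {π : ι → N} (h : ∀ ⦃n : ℕ⦄ (φ : setLang.Formula (Fin n)) (s : Fin n → ι),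
      φ.Realize (π ∘ s) ↔ ∀ᶠ i in F, φ.Realize fun j => g (s j) i) (k l : ι) :
    (π k).1 ∈ (π l).1 ↔ ∀ᶠ i in F, (g k i).1 ∈ (g l i).1 := by
  obtain ⟨φ, hφ⟩ : IsFirstOrder.{u} fun _ (v : Fin 2 → _) => (v 0).1 ∈ (v 1).1 := .mem 0 1
  exact (hφ _ _).symm.trans <| (h φ ![k, l]).trans <| eventually_congr <| .of_forall fun i => hφ _ _

theorem collapse_eq {ι I : Type*} {S : Set ZFSet.{u}} {g : ι → I → S} {F : Filter I} {N : ZFSet.{u}}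
    {π : ι → (N : Set ZFSet.{u})} (hN : N.IsTransitive) (surj : Function.Surjective π)
    (mem_iff : ∀ k l, (π k).1 ∈ (π l).1 ↔ ∀ᶠ i in F, (g k i).1 ∈ (g l i).1)
    {x : ZFSet.{u}} {l : ι}
    (hl : ∀ k, (∀ᶠ i in F, (g k i).1 ∈ (g l i).1) ↔
      ∃ y ∈ x, ∀ᶠ i in F, (g k i).1 = y)
    (exists_eventually_eq : ∀ y ∈ x, ∃ k, ∀ᶠ i in F, (g k i).1 = y)
    (eq : ∀ y ∈ x, ∀ k, (∀ᶠ i in F, (g k i).1 = y) → (π k).1 = y) :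
    (π l).1 = x := by
  refine ZFSet.ext fun z => ⟨fun hz => ?_, fun hz => ?_⟩
  · obtain ⟨k, hk⟩ := surj ⟨z, hN _ (π l).2 hz⟩
    obtain rfl : (π k).1 = z := congrArg Subtype.val hk
    obtain ⟨y, hy, hky⟩ := (hl k).1 ((mem_iff k l).1 hz)
    rwa [eq y hy k hky]
  · obtain ⟨k, hk⟩ := exists_eventually_eq z hz
    rw [← eq z hz k hk]
    exact (mem_iff k l).2 ((hl k).2 ⟨z, hz, hk⟩)

/-- The requirement on `A ⊆ κ` and `H(θ)` in the definition of `κ` being `κ`-Ramsey. -/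
def HasRamseyModel (κ θ : Cardinal.{u}) (A : ZFSet.{u}) : Prop :=
  ∃ M : ZFSet.{u}, A ∈ M ∧ IsWeakModel κ M ∧
    IsElementarySubmodel (M : Set ZFSet.{u}) (H θ) ∧ ClosedUnderSeq κ M ∧
    ∃ N : ZFSet.{u}, N.IsTransitive ∧
      ∃ j : (M : Set ZFSet.{u}) ↪ₑ[setLang] (N : Set ZFSet.{u}), IsPowersetPreserving κ j

/-- A presentation of the models `M` and `N` and of the embedding `j : M → N` that witness that `κ`
is `κ`-Ramsey: `M` consists of the sets `e k`, `N` is the collapse of the functions `g k` modulo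
`U`, `j` sends `e k` to the class of `g (J k)`, and the class of `g top` is `κ`. -/
structure IsRamseySystem (κ : Cardinal.{u}) {θ : Cardinal.{u}} {ι I : Type u} (U : Ultrafilter I)
    (e : ι → H θ) (g : ι → I → H θ) (J : ι → ι) (top : ι) : Prop where
  skolem_left : IsSkolemClosed setLang fun k (_ : Unit) => e k
  skolem_right : IsSkolemClosed setLang g
  realize_iff : ∀ ⦃n : ℕ⦄ (φ : setLang.Formula (Fin n)) (s : Fin n → ι),
    φ.Realize (e ∘ s) ↔ ∀ᶠ i in (U : Filter I), φ.Realize fun j => g (J (s j)) i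
  card_le : #ι ≤ κ
  succ_subset : (κ.ord + 1).toZFSet ⊆ ZFSet.range fun k => (e k).1
  closedUnderSeq : ClosedUnderSeq κ (ZFSet.range fun k => (e k).1)
  image_eq : ∀ k, (e k).1 ∈ κ.ord.toZFSet → ∀ᶠ i in (U : Filter I), g (J k) i = e k
  mem_top_iff : ∀ l, (∀ᶠ i in (U : Filter I), (g l i).1 ∈ (g top i).1) ↔
    ∃ x ∈ κ.ord.toZFSet, ∀ᶠ i in (U : Filter I), (g l i).1 = x
  top_mem_image : ∀ k, (e k).1 = κ.ord.toZFSet →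
    ∀ᶠ i in (U : Filter I), (g top i).1 ∈ (g (J k) i).1
  exists_trace : ∀ k, ∃ l, ∀ x, x ∈ (e l).1 ↔
    x ∈ κ.ord.toZFSet ∧ ∀ᶠ i in (U : Filter I), x ∈ (g k i).1

namespace IsRamseySystem

variable {κ θ : Cardinal.{u}} {ι I : Type u} {U : Ultrafilter I} {e : ι → H θ}
  {g : ι → I → H θ} {J : ι → ι} {top : ι}

theorem isElementarySubmodel (h : IsRamseySystem κ U e g J top) :
    IsElementarySubmodel (ZFSet.range fun k => (e k).1 : Set ZFSet.{u}) (H θ) := by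
  convert h.skolem_left.isElementarySubmodel
  ext
  simp

theorem isWeakModel (h : IsRamseySystem κ U e g J top) (hθ : θ.IsRegular) (hω : ℵ₀ < θ) :
    IsWeakModel κ (ZFSet.range fun k => (e k).1) where
  card_eq := by
    refine ((card_range_le _).trans h.card_le).antisymm ?_
    simpa using (Ordinal.card_le_card (Order.le_succ κ.ord)).trans
      ((Ordinal.card_toZFSet _).ge.trans (ZFSet.card_mono h.succ_subset))
  succ_subset := h.succ_subset
  models := (modelsZFCMinus_H hθ hω).of_elementarilyEquivalent
    h.isElementarySubmodel.elementarilyEquivalent.symm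

theorem exists_eq_of_mem (h : IsRamseySystem κ U e g J top) {x : ZFSet.{u}}
    (hx : x ∈ κ.ord.toZFSet) : ∃ k, (e k).1 = x :=
  ZFSet.mem_range.1 (h.succ_subset (by simp [hx]))

theorem exists_eq_ord (h : IsRamseySystem κ U e g J top) : ∃ k, (e k).1 = κ.ord.toZFSet :=
  ZFSet.mem_range.1 (h.succ_subset (by simp))

section Collapse

variable {N : ZFSet.{u}} {π : ι → (N : Set ZFSet.{u})}

theorem collapse_eq_of_eventually_eq [CardinalInterFilter (U : Filter I) κ]
    (h : IsRamseySystem κ U e g J top) (hN : N.IsTransitive) (surj : Function.Surjective π)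
    (mem_iff : ∀ k l, (π k).1 ∈ (π l).1 ↔ ∀ᶠ i in (U : Filter I), (g k i).1 ∈ (g l i).1)
    (x : ZFSet.{u}) : x ∈ κ.ord.toZFSet →
      ∀ l, (∀ᶠ i in (U : Filter I), (g l i).1 = x) → (π l).1 = x := by
  induction x using ZFSet.inductionOn with
  | _ x ih =>
  intro hx l hl
  have hxκ (y) (hy : y ∈ x) : y ∈ κ.ord.toZFSet :=
    (ZFSet.isOrdinal_toZFSet _).isTransitive _ hx hy
  refine collapse_eq hN surj mem_iff (fun k => ?_) (fun y hy => ?_) fun y hy => ih y hy (hxκ y hy)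
  · rw [← eventually_mem_iff_exists_eventually_eq (card_lt_of_mem_toZFSet_ord hx)]
    exact eventually_congr (hl.mono fun i hi => by rw [hi])
  · obtain ⟨k, rfl⟩ := h.exists_eq_of_mem (hxκ y hy)
    exact ⟨J k, (h.image_eq k (hxκ _ hy)).mono fun i hi => congrArg Subtype.val hi⟩

theorem isPowersetPreserving [CardinalInterFilter (U : Filter I) κ]
    (h : IsRamseySystem κ U e g J top) (hN : N.IsTransitive) (surj : Function.Surjective π)
    (realize_iff : ∀ ⦃n : ℕ⦄ (φ : setLang.Formula (Fin n)) (s : Fin n → ι),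
      φ.Realize (π ∘ s) ↔ ∀ᶠ i in (U : Filter I), φ.Realize fun j => g (s j) i)
    (models : ModelsZFCMinus (ZFSet.range fun k => (e k).1 : Set ZFSet.{u}))
    {j : (ZFSet.range fun k => (e k).1 : Set ZFSet.{u}) ↪ₑ[setLang] (N : Set ZFSet.{u})}
    (hj : ∀ k, j ⟨(e k).1, ZFSet.mem_range_self k⟩ = π (J k)) : IsPowersetPreserving κ j := by
  have mem_iff := mem_iff_of_realize_iff_eventually realize_iff
  have π_eq := h.collapse_eq_of_eventually_eq hN surj mem_iff
  have eventually_image (k) (hk : (e k).1 ∈ κ.ord.toZFSet) :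
      ∀ᶠ i in (U : Filter I), (g (J k) i).1 = (e k).1 :=
    (h.image_eq k hk).mono fun i hi => congrArg Subtype.val hi
  have fix (k) (hk : (e k).1 ∈ κ.ord.toZFSet) : (π (J k)).1 = (e k).1 :=
    π_eq _ hk _ (eventually_image k hk)
  have mem_π_iff {x} (hx : x ∈ κ.ord.toZFSet) (k) :
      x ∈ (π k).1 ↔ ∀ᶠ i in (U : Filter I), x ∈ (g k i).1 := by
    obtain ⟨m, rfl⟩ := h.exists_eq_of_mem hx
    rw [← fix m hx, mem_iff, fix m hx]
    exact eventually_congr ((eventually_image m hx).mono fun i hi => by rw [hi])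
  have π_top : (π top).1 = κ.ord.toZFSet := by
    refine collapse_eq hN surj mem_iff h.mem_top_iff (fun x hx => ?_) π_eq
    obtain ⟨k, rfl⟩ := h.exists_eq_of_mem hx
    exact ⟨J k, eventually_image k hx⟩
  obtain ⟨c, hc⟩ := h.exists_eq_ord
  refine isPowersetPreserving_of_isTransitive hN
    (models.of_elementarilyEquivalent j.elementarilyEquivalent) (π_top ▸ (π top).2) j ?_
    ⟨⟨_, ZFSet.mem_range_self c⟩, hc, ?_⟩ ?_ ?_
  · rintro ⟨x, hxM⟩ hx
    obtain ⟨k, rfl⟩ := h.exists_eq_of_mem hx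
    rw [hj, fix k hx]
  · rw [hj, hc]
    exact fun hJ => ZFSet.mem_irrefl _ (π_top ▸ hJ ▸ (mem_iff top (J c)).2 (h.top_mem_image c hc))
  · exact fun x hx => ZFSet.mem_range.2 (h.exists_eq_of_mem hx)
  · intro X hX hXκ
    obtain ⟨k, hk⟩ := surj ⟨X, hX⟩
    obtain ⟨l, hl⟩ := h.exists_trace k
    obtain rfl : (π k).1 = X := congrArg Subtype.val hk
    exact ZFSet.mem_range.2 ⟨l, ZFSet.ext fun x => (hl x).trans
      ⟨fun hx => (mem_π_iff hx.1 k).2 hx.2, fun hx => ⟨hXκ hx, (mem_π_iff (hXκ hx) k).1 hx⟩⟩⟩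

end Collapse

theorem hasRamseyModel [CardinalInterFilter (U : Filter I) κ] (h : IsRamseySystem κ U e g J top)
    (hκ : ℵ₀ < κ) (hθ : θ.IsRegular) (hω : ℵ₀ < θ) (k : ι) : HasRamseyModel κ θ (e k) := by
  have := CardinalInterFilter.toCountableInterFilter (U : Filter I) hκ
  obtain ⟨N, hN, π, surj, realize_iff⟩ :=
    h.skolem_right.exists_collapse (modelsZFCMinus_H hθ hω).extensionality U
  have hM := h.isWeakModel hθ hω
  let p (k : ι) : (ZFSet.range fun k => (e k).1 : Set ZFSet.{u}) :=
    ⟨(e k).1, ZFSet.mem_range_self k⟩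
  obtain ⟨j, hj⟩ := exists_elementaryEmbedding_of_realize_iff (L := setLang) (e := p) (p := π ∘ J)
    (fun ⟨x, hx⟩ => (ZFSet.mem_range.1 hx).imp fun k hk => Subtype.ext hk) fun n φ s =>
      (realize_iff φ (J ∘ s)).trans ((h.realize_iff φ s).symm.trans
        (h.isElementarySubmodel.2 φ (p ∘ s)))
  exact ⟨_, ZFSet.mem_range_self k, hM, h.isElementarySubmodel, h.closedUnderSeq, N, hN, j,
    h.isPowersetPreserving hN surj realize_iff hM.models hj⟩

end IsRamseySystem

/-! ### Normal measures -/

theorem exists_forall_lt_of_lt_cof {α : Type u} [LinearOrder α] {ι : Type u}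
    (hι : #ι < Order.cof α) (f : ι → α) : ∃ b, ∀ i, f i < b := by
  by_contra! h
  have hf : IsCofinal (range f) := fun b => (h b).imp' f fun i hi => ⟨⟨i, rfl⟩, hi⟩
  exact ((Order.cof_le hf).trans mk_range_le).not_gt hι

theorem mk_Iio_toType_lt {κ : Cardinal.{u}} (a : κ.ord.ToType) : #(Iio a) < κ := by
  simpa using Cardinal.mk_Iio_lt a (by simp)

theorem mk_Iic_toType_lt {κ : Cardinal.{u}} (hκ : ℵ₀ ≤ κ) (a : κ.ord.ToType) : #(Iic a) < κ := by
  rw [← Iio_insert]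
  exact mk_insert_le.trans_lt (add_lt_of_lt hκ (mk_Iio_toType_lt a) (one_lt_aleph0.trans_le hκ))

theorem eventually_iff_eventually {I : Type u} (U : Ultrafilter I) (p : I → Prop) :
    ∀ᶠ a in (U : Filter I), (p a ↔ ∀ᶠ y in U, p y) := by
  by_cases h : ∀ᶠ y in U, p y
  · exact h.mono fun a ha => iff_of_true ha h
  · exact (Ultrafilter.eventually_not.2 h).mono fun a ha => iff_of_false ha h

section Complete

variable {κ : Cardinal.{u}} {U : Ultrafilter κ.ord.ToType}
  [CardinalInterFilter (U : Filter κ.ord.ToType) κ]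

theorem eventually_gt_of_nonprincipal (hκ : ℵ₀ ≤ κ) (hU : ∀ x, {x} ∉ U) (a : κ.ord.ToType) :
    ∀ᶠ x in U, a < x := by
  have h : ∀ᶠ x : κ.ord.ToType in U, ∀ y : Iic a, x ≠ y := by
    rw [eventually_cardinal_forall (mk_Iic_toType_lt hκ a)]
    exact fun y => Ultrafilter.compl_mem_iff_notMem.2 (hU y)
  exact h.mono fun x hx => not_le.1 fun hxa => hx ⟨x, hxa⟩ rfl

theorem isRegular_of_nonprincipal (hκ : ℵ₀ ≤ κ) (hU : ∀ x, {x} ∉ U) : κ.IsRegular := by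
  refine ⟨hκ, ?_⟩
  by_contra! h
  rw [← Ordinal.cof_toType] at h
  obtain ⟨s, hs, hsc⟩ := Order.exists_cof_eq κ.ord.ToType
  have hbound : ∀ᶠ x in U, ∀ y : s, y.1 < x := by
    rw [eventually_cardinal_forall (hsc.trans_lt h)]
    exact fun y => eventually_gt_of_nonprincipal hκ hU _
  obtain ⟨x, hx⟩ := hbound.exists
  obtain ⟨y, hy, hxy⟩ := hs x
  exact (hx ⟨y, hy⟩).not_ge hxy

theorem isStrongLimit_of_nonprincipal (hκ : ℵ₀ ≤ κ) (hU : ∀ x, {x} ∉ U) : κ.IsStrongLimit := by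
  refine ⟨(aleph0_pos.trans_le hκ).ne', fun c hc => ?_⟩
  by_contra! h
  obtain ⟨e⟩ : #κ.ord.ToType ≤ #(Set c.out) := by simpa using h
  have hconst : ∀ᶠ x in U, ∀ i : c.out, i ∈ e x ↔ ∀ᶠ y in U, i ∈ e y := by
    rw [eventually_cardinal_forall (by simpa using hc)]
    exact fun i => eventually_iff_eventually U fun x => i ∈ e x
  obtain ⟨x, hx⟩ := hconst.exists
  refine hU x (mem_of_superset hconst fun y hy => ?_)
  exact e.injective (Set.ext fun i => (hy i).trans (hx i).symm)

theorem isInaccessible_of_nonprincipal (hκ : ℵ₀ < κ) (hU : ∀ x, {x} ∉ U) : κ.IsInaccessible :=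
  isInaccessible_def.2
    ⟨hκ, isRegular_of_nonprincipal hκ.le hU, isStrongLimit_of_nonprincipal hκ.le hU⟩

end Complete

/-- A normal measure on `κ`: a `<κ`-complete ultrafilter that contains the final segments of `κ`
and for which every regressive function is constant on a large set. -/
structure IsNormalMeasure {κ : Cardinal.{u}} (U : Ultrafilter κ.ord.ToType) : Prop
    extends CardinalInterFilter (U : Filter κ.ord.ToType) κ where
  eventually_gt : ∀ a, ∀ᶠ x : κ.ord.ToType in U, a < x
  exists_eventually_eq : ∀ f : κ.ord.ToType → κ.ord.ToType, (∀ᶠ x in U, f x < x) →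
    ∃ c, ∀ᶠ x in U, f x = c

theorem exists_isNormalMeasure {κ : Cardinal.{u}} {U : Ultrafilter κ.ord.ToType}
    [CardinalInterFilter (U : Filter κ.ord.ToType) κ] (hκ : ℵ₀ < κ) (hU : ∀ x, {x} ∉ U) :
    ∃ W : Ultrafilter κ.ord.ToType, IsNormalMeasure W := by
  let r : (κ.ord.ToType → κ.ord.ToType) → (κ.ord.ToType → κ.ord.ToType) → Prop :=
    fun f g => ∀ᶠ x in U, f x < g x
  have : CountableInterFilter (U : Filter κ.ord.ToType) :=
    CardinalInterFilter.toCountableInterFilter (c := κ) _ hκ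
  have hr : WellFounded r := by
    rw [wellFounded_iff_isEmpty_descending_chain]
    refine ⟨fun ⟨g, hg⟩ => ?_⟩
    obtain ⟨x, hx⟩ := (eventually_countable_forall.2 hg).exists
    exact (wellFounded_iff_isEmpty_descending_chain.1
      (wellFounded_lt (α := κ.ord.ToType))).false ⟨fun n => g n x, hx⟩
  -- `f` represents `κ` in the ultrapower by `U`.
  obtain ⟨f, hf, hmin⟩ := hr.has_min {f | ∀ a, ∀ᶠ x in U, a < f x}
    ⟨id, eventually_gt_of_nonprincipal hκ.le hU⟩
  have : CardinalInterFilter (U.map f : Filter κ.ord.ToType) κ :=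
    inferInstanceAs (CardinalInterFilter (Filter.map f U) κ)
  refine ⟨U.map f, { eventually_gt := hf, exists_eventually_eq := fun g hg => ?_ }⟩
  obtain ⟨a, ha⟩ := not_forall.1 fun h => hmin (g ∘ f) h hg
  by_contra! hc
  have hne : ∀ᶠ x in U, ∀ c : Iic a, g (f x) ≠ c := by
    rw [eventually_cardinal_forall (mk_Iic_toType_lt hκ.le a)]
    exact fun c => hc c
  exact ha (hne.mono fun x hx => not_le.1 fun h => hx ⟨_, h⟩ rfl)

theorem mk_Iio_eq_card_toOrd {o : Ordinal.{u}} (a : o.ToType) : #(Iio a) = a.toOrd.1.card :=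
  (Ordinal.card_typein (α := o.ToType) (r := (· < ·)) a).symm

theorem isRegular_card_of_le_ord_cof {o : Ordinal.{u}} (hω : Ordinal.omega0 ≤ o)
    (ho : o ≤ o.cof.ord) : o.card.IsRegular ∧ o.card.ord = o := by
  have hcof : o.cof.ord = o := (Ordinal.ord_cof_le o).antisymm ho
  have hcard : o.cof = o.card := by rw [← card_ord o.cof, hcof]
  rw [← hcard]
  exact ⟨⟨hcard ▸ Ordinal.aleph0_le_card.2 hω, by rw [hcof]⟩, hcof⟩

namespace IsNormalMeasure

variable {κ : Cardinal.{u}} {U : Ultrafilter κ.ord.ToType}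

theorem eventually_forall_tuple (hU : IsNormalMeasure U) {A : Type u} (hA : #A < κ)
    {Q : (A → κ.ord.ToType) → κ.ord.ToType → Prop} (h : ∀ s, ∀ᶠ a in U, Q s a) :
    ∀ᶠ a in U, ∀ s : A → κ.ord.ToType, (∀ i, s i < a) → Q s a := by
  have := hU.toCardinalInterFilter
  by_contra hc
  simp only [← Ultrafilter.eventually_not, not_forall, exists_prop] at hc
  obtain ⟨a₀, s₀, -⟩ := hc.exists
  have : Nonempty (A → κ.ord.ToType) := ⟨s₀⟩
  choose! s hs hQ using fun a (ha : ∃ s : A → κ.ord.ToType, (∀ i, s i < a) ∧ ¬ Q s a) => ha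
  choose t ht using fun i =>
    hU.exists_eventually_eq (fun a => s a i) (hc.mono fun a ha => hs a ha i)
  obtain ⟨a, ⟨ha, hst⟩, hQt⟩ :=
    ((hc.and ((eventually_cardinal_forall hA).2 ht)).and (h t)).exists
  exact hQ a ha (funext hst ▸ hQt)

theorem eventually_forall_lt (hU : IsNormalMeasure U) (hκ : ℵ₀ ≤ κ)
    {p : κ.ord.ToType → κ.ord.ToType → Prop} (h : ∀ c, ∀ᶠ a in U, p c a) :
    ∀ᶠ a in U, ∀ c < a, p c a := by
  have := hU.eventually_forall_tuple (A := PUnit) (by simpa using one_lt_aleph0.trans_le hκ)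
    (fun s => h (s ⟨⟩))
  exact this.mono fun a ha c hc => ha (fun _ => c) fun _ => hc

theorem eventually_forall_tuple_exists_lt (hU : IsNormalMeasure U) {A : Type u} (hA : #A < κ)
    {R : (A → κ.ord.ToType) → κ.ord.ToType → Prop} (h : ∀ s, ∃ k, R s k) :
    ∀ᶠ a in U, ∀ s : A → κ.ord.ToType, (∀ i, s i < a) → ∃ k < a, R s k :=
  hU.eventually_forall_tuple hA fun s =>
    let ⟨k, hk⟩ := h s
    (hU.eventually_gt k).mono fun _ hka => ⟨k, hka, hk⟩

theorem eventually_forall_lt_exists_lt (hU : IsNormalMeasure U) (hκ : ℵ₀ ≤ κ)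
    {R : κ.ord.ToType → κ.ord.ToType → Prop} (h : ∀ c, ∃ k, R c k) :
    ∀ᶠ a in U, ∀ c < a, ∃ k < a, R c k :=
  hU.eventually_forall_lt hκ fun c =>
    let ⟨k, hk⟩ := h c
    (hU.eventually_gt k).mono fun _ hka => ⟨k, hka, hk⟩

theorem eventually_bounded (hU : IsNormalMeasure U) (hκ : κ.IsRegular) :
    ∀ᶠ a in U, ∀ c < a, ∀ s : Iio c → κ.ord.ToType, (∀ i, s i < a) → ∃ b < a, ∀ i, s i < b := by
  refine hU.eventually_forall_lt hκ.aleph0_le fun c => ?_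
  exact hU.eventually_forall_tuple_exists_lt (mk_Iio_toType_lt c) fun s =>
    exists_forall_lt_of_lt_cof
      (by rw [Ordinal.cof_toType, hκ.cof_ord]; exact mk_Iio_toType_lt c) s

theorem eventually_gt_ordinal (hU : IsNormalMeasure U) {o : Ordinal.{u}} (ho : o < κ.ord) :
    ∀ᶠ a : κ.ord.ToType in U, o < a.toOrd := by
  filter_upwards [hU.eventually_gt (Ordinal.ToType.mk ⟨o, ho⟩)] with a ha
  exact Ordinal.ToType.mk.lt_symm_apply.2 ha

theorem eventually_isRegular (hU : IsNormalMeasure U) (hκ : κ.IsRegular) (hκ' : ℵ₀ < κ) :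
    ∀ᶠ a : κ.ord.ToType in U, (#(Iio a)).IsRegular ∧ (#(Iio a)).ord = a.toOrd := by
  filter_upwards [hU.eventually_bounded hκ,
    hU.eventually_gt_ordinal (ord_aleph0 ▸ ord_lt_ord.2 hκ')] with a ha hω
  rw [mk_Iio_eq_card_toOrd]
  refine isRegular_card_of_le_ord_cof hω.le (not_lt.1 fun hlt => ?_)
  let c : κ.ord.ToType := Ordinal.ToType.mk ⟨_, hlt.trans a.toOrd.2⟩
  have hc : c.toOrd = (a.toOrd.1.cof).ord := by simp [c]
  obtain ⟨s, hs, hsc⟩ := Order.exists_cof_eq (Iio a)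
  obtain ⟨e⟩ : Nonempty (Iio c ≃ s) := by
    rw [← Cardinal.eq, mk_Iio_eq_card_toOrd, hc, card_ord, hsc, Order.cof_Iio]
    rfl
  obtain ⟨b, hba, hb⟩ := ha c (Ordinal.ToType.mk.symm.lt_iff_lt.1 (hc.trans_lt hlt))
    (fun i => (e i).1) fun i => (e i).1.2
  obtain ⟨z, hz, hbz⟩ := hs ⟨b, hba⟩
  have := hb (e.symm ⟨z, hz⟩)
  rw [Equiv.apply_symm_apply] at this
  exact this.not_ge hbz

end IsNormalMeasure

/-! ### Hulls of functions into `H(θ)` -/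

theorem power_le_self_of_isInaccessible {κ c : Cardinal.{u}} (hκ : κ.IsInaccessible) (hc : c < κ) :
    κ ^ c ≤ κ := by
  have hmk : #(κ.out × κ.out) = κ := by simpa using mul_eq_self hκ.aleph0_lt.le
  obtain ⟨e⟩ : #c.out ≤ #κ.out := by simpa using hc.le
  let graph (s : c.out → κ.out) : {G : Set (κ.out × κ.out) // #G < (#(κ.out × κ.out)).ord.cof} :=
    ⟨range fun i => (e i, s i),
      mk_range_le.trans_lt (by rwa [hmk, hκ.isRegular.cof_ord, mk_out])⟩
  have hgraph : Function.Injective graph := by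
    intro s t h
    ext i
    obtain ⟨j, hj⟩ : (e i, s i) ∈ (graph t).1 := h ▸ mem_range_self i
    obtain ⟨hji, hts⟩ := Prod.ext_iff.1 hj
    obtain rfl : j = i := e.injective hji
    exact hts.symm
  calc κ ^ c = #(c.out → κ.out) := by simp
    _ ≤ _ := mk_le_of_injective hgraph
    _ = κ := by
      rw [mk_subset_mk_lt_cof, hmk]
      exact hmk.symm ▸ hκ.isStrongLimit.isStrongPrelimit

theorem exists_enumeration {κ : Cardinal.{u}} (hκ : ℵ₀ ≤ κ) {T : Type v} [Nonempty T] {R : Type u}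
    (hR : #R ≤ κ) (bound : R → κ.ord.ToType) (val : R → (κ.ord.ToType → T) → T)
    (hval : ∀ r f g, (∀ i < bound r, f i = g i) → val r f = val r g) :
    ∃ f : κ.ord.ToType → T, ∀ r, ∃ k, f k = val r f := by
  rcases isEmpty_or_nonempty R with hR₀ | hR₀
  · exact ⟨fun _ => Classical.arbitrary T, fun r => hR₀.elim r⟩
  obtain ⟨e⟩ : Nonempty (κ.ord.ToType ≃ κ.ord.ToType × R) := by
    rw [← Cardinal.eq, mk_prod, lift_id, lift_id, mk_ord_toType]
    exact (mul_eq_left hκ hR (mk_ne_zero R)).symm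
  let F (k : κ.ord.ToType) (f : ∀ i, i < k → T) : T :=
    val (e k).2 fun i => if h : i < k then f i h else Classical.arbitrary T
  let f := (wellFounded_lt (α := κ.ord.ToType)).fix F
  have hf k : f k = val (e k).2 fun i => if i < k then f i else Classical.arbitrary T := by
    simpa only [F, dite_eq_ite] using (wellFounded_lt (α := κ.ord.ToType)).fix_eq F k
  refine ⟨f, fun r => ?_⟩
  obtain ⟨k, hk, rfl⟩ : ∃ k, bound r ≤ k ∧ (e k).2 = r := by
    by_contra! h
    have hlt i : e.symm (i, r) < bound r := not_le.1 fun hle => h _ hle (by simp)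
    refine ((mk_ord_toType κ).symm.trans_le (mk_le_of_injective
      (f := fun i => (⟨_, hlt i⟩ : Iio (bound r))) fun i j hij => ?_)).not_gt (mk_Iio_toType_lt _)
    simpa using congrArg Subtype.val hij
  exact ⟨k, (hf k).trans (hval _ _ _ fun i hi => if_pos (hi.trans_le hk))⟩

theorem exists_forall_exists_eq_comp {κ : Cardinal.{u}} (hκ : κ.IsInaccessible) {T : Type v}
    [Nonempty T] {D : Type u} (hD : #D ≤ κ) (A : D → Type u) (hA : ∀ d, #(A d) < κ)
    (op : ∀ d, (A d → T) → T) :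
    ∃ f : κ.ord.ToType → T, ∀ d (s : A d → κ.ord.ToType), ∃ k, f k = op d (f ∘ s) := by
  have hR : #(Σ d, A d → κ.ord.ToType) ≤ κ := by
    calc #(Σ d, A d → κ.ord.ToType) = sum fun d => κ ^ #(A d) := by simp
      _ ≤ sum fun _ : D => κ :=
        sum_le_sum _ _ fun d => power_le_self_of_isInaccessible hκ (hA d)
      _ ≤ κ * κ := by simpa using mul_le_mul_left hD κ
      _ = κ := mul_eq_self hκ.aleph0_lt.le
  choose bound hbound using fun r : Σ d, A d → κ.ord.ToType =>
    exists_forall_lt_of_lt_cof (by rw [Ordinal.cof_toType, hκ.isRegular.cof_ord]; exact hA r.1) r.2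
  obtain ⟨f, hf⟩ := exists_enumeration hκ.aleph0_lt.le hR bound (fun r f => op r.1 (f ∘ r.2))
    fun r f g h => congrArg _ (funext fun i => h _ (hbound r i))
  exact ⟨f, fun d s => hf ⟨d, s⟩⟩

instance countable_symbols_setLang : Countable setLang.Symbols := by
  have : Countable (Σ l, setLang.Functions l) :=
    inferInstanceAs (Countable (Σ _ : ℕ, Empty))
  have : Subsingleton (Σ l, setLang.Relations l) := ⟨by rintro ⟨_, ⟨⟩⟩ ⟨_, ⟨⟩⟩; rfl⟩
  exact instCountableSum

instance countable_boundedFormula_setLang (m n : ℕ) :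
    Countable (setLang.BoundedFormula (Fin m) n) :=
  (sigma_mk_injective (i := n)).countable

theorem mem_toZFSet_iff_exists_toType {o : Ordinal.{u}} {z : ZFSet.{u}} :
    z ∈ o.toZFSet ↔ ∃ i : o.ToType, i.toOrd.1.toZFSet = z := by
  rw [Ordinal.mem_toZFSet_iff]
  exact ⟨fun ⟨x, hx, h⟩ => ⟨Ordinal.ToType.mk ⟨x, hx⟩, by simpa using h⟩,
    fun ⟨i, h⟩ => ⟨_, i.toOrd.2, h⟩⟩

/-- The function with domain the ordinal `o` and values `s`, as a set. -/
noncomputable def sequence {o : Ordinal.{u}} (s : o.ToType → ZFSet.{u}) : ZFSet.{u} :=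
  ZFSet.range fun i => ZFSet.pair i.toOrd.1.toZFSet (s i)

theorem sequence_mem_H {θ : Cardinal.{u}} (hθ : θ.IsRegular) {o : Ordinal.{u}} (ho : o < θ.ord)
    {s : o.ToType → ZFSet.{u}} (hs : ∀ i, s i ∈ H θ) : sequence s ∈ H θ :=
  range_mem_H hθ (by simpa using lt_ord.1 ho) fun i =>
    pair_mem_H hθ (toZFSet_mem_H (lt_ord.1 ((Ordinal.ToType.toOrd i).2.trans ho))) (hs i)

theorem exists_eq_sequence_of_isFunc {o : Ordinal.{u}} {M f : ZFSet.{u}}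
    (hf : ZFSet.IsFunc o.toZFSet M f) :
    ∃ s : o.ToType → ZFSet.{u}, (∀ i, s i ∈ M) ∧ f = sequence s := by
  choose s hs hs' using fun i : o.ToType => hf.2 _ (mem_toZFSet_iff_exists_toType.2 ⟨i, rfl⟩)
  refine ⟨s, fun i => (ZFSet.pair_mem_prod.1 (hf.1 (hs i))).2, ZFSet.ext fun p => ?_⟩
  rw [sequence, ZFSet.mem_range]
  refine ⟨fun hp => ?_, fun ⟨i, hi⟩ => hi ▸ hs i⟩
  obtain ⟨a, ha, w, -, rfl⟩ := ZFSet.mem_prod.1 (hf.1 hp)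
  obtain ⟨i, rfl⟩ := mem_toZFSet_iff_exists_toType.1 ha
  exact ⟨i, by rw [hs' i w hp]⟩

/-- The family `f` of functions from `Q` to `H θ` contains the ordinals below `κ` as constant
functions, and is closed under pointwise Skolem functions and under the pointwise formation of
sequences of length less than `κ`. -/
structure IsHull (κ : Cardinal.{u}) {θ : Cardinal.{u}} {ι : Type v} {Q : Type w}
    (f : ι → Q → H θ) : Prop where
  isSkolemClosed : IsSkolemClosed setLang f
  exists_eq_toZFSet : ∀ o < κ.ord, ∃ k, ∀ q, (f k q).1 = o.toZFSet
  exists_eq_sequence : ∀ o < κ.ord, ∀ s : o.ToType → ι,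
    ∃ k, ∀ q, (f k q).1 = sequence fun i => (f (s i) q).1

theorem exists_isHull {κ θ : Cardinal.{u}} (hκ : κ.IsInaccessible) (hθ : θ.IsRegular) (hκθ : κ ≤ θ)
    {Q : Type v} {O : Type u} (hO : #O ≤ κ) (op : O → (Q → H θ) → Q → H θ) :
    ∃ f : κ.ord.ToType → Q → H θ, IsHull κ f ∧ ∀ o k, ∃ l, f l = op o (f k) := by
  let S := Σ m n : ℕ, setLang.BoundedFormula (Fin m) (n + 1)
  let K := κ.ord.ToType
  have hK (i : K) : i.toOrd.1 < θ.ord := i.toOrd.2.trans_le (ord_le_ord.2 hκθ)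
  have : Nonempty (H θ) := ⟨⟨_, toZFSet_mem_H (o := 0) (by simpa using hθ.pos)⟩⟩
  -- The four summands index the constants, the sequences, the operations and the Skolem functions.
  have hD : #((K ⊕ K) ⊕ (O ⊕ ULift.{u} S)) ≤ κ := by
    simp only [mk_sum, lift_id]
    refine add_le_of_le hκ.aleph0_lt.le (add_le_of_le hκ.aleph0_lt.le ?_ ?_)
      (add_le_of_le hκ.aleph0_lt.le hO (mk_le_aleph0.trans hκ.aleph0_lt.le))
    all_goals exact (mk_ord_toType κ).le
  obtain ⟨f, hf⟩ := exists_forall_exists_eq_comp hκ hD (T := Q → H θ)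
    (Sum.elim (Sum.elim (fun _ => PEmpty) fun i => i.toOrd.1.ToType)
      (Sum.elim (fun _ => PUnit) fun φ => ULift (Fin φ.down.1 ⊕ Fin φ.down.2.1)))
    (by
      rintro ((i | i) | (o | φ))
      · simpa using hκ.pos
      · simpa using lt_ord.1 i.toOrd.2
      · simpa using hκ.nat_lt 1
      · exact (lt_aleph0_of_finite (ULift (Fin _ ⊕ Fin _))).trans hκ.aleph0_lt)
    (fun
      | .inl (.inl i) => fun _ _ => ⟨_, toZFSet_mem_H (lt_ord.1 (hK i))⟩
      | .inl (.inr i) => fun s q => ⟨_, sequence_mem_H hθ (hK i) fun j => (s j q).2⟩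
      | .inr (.inl o) => fun s => op o (s ⟨⟩)
      | .inr (.inr φ) => fun s q => Classical.epsilon fun y =>
          φ.down.2.2.Realize (fun j => s ⟨.inl j⟩ q) (Fin.snoc (fun j => s ⟨.inr j⟩ q) y))
  refine ⟨f, ⟨fun m n φ s t => ?_, fun o ho => ?_, fun o ho s => ?_⟩, fun o k => ?_⟩
  · obtain ⟨k, hk⟩ := hf (.inr (.inr ⟨m, n, φ⟩)) fun j => j.down.elim s t
    exact ⟨k, fun q hq => hk ▸ Classical.epsilon_spec hq⟩
  · obtain ⟨k, hk⟩ := hf (.inl (.inl (Ordinal.ToType.mk ⟨o, ho⟩))) PEmpty.elim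
    exact ⟨k, fun q => by simp [hk]⟩
  · obtain ⟨i, rfl⟩ : ∃ i : K, i.toOrd.1 = o := ⟨Ordinal.ToType.mk ⟨o, ho⟩, by simp⟩
    obtain ⟨k, hk⟩ := hf (.inl (.inr i)) s
    exact ⟨k, fun q => by rw [hk]; rfl⟩
  · exact hf (.inr (.inl o)) fun _ => k

namespace IsHull

variable {κ θ : Cardinal.{u}} {ι : Type u} {Q : Type v} {f : ι → Q → H θ}

theorem succ_subset (hf : IsHull κ f) {q : Q} {k : ι} (hk : (f k q).1 = κ.ord.toZFSet) :
    (κ.ord + 1).toZFSet ⊆ ZFSet.range fun k => (f k q).1 := by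
  intro z hz
  rw [Ordinal.toZFSet_add_one, ZFSet.mem_insert_iff] at hz
  rw [ZFSet.mem_range]
  rcases hz with rfl | hz
  · exact ⟨k, hk⟩
  · obtain ⟨o, ho, rfl⟩ := Ordinal.mem_toZFSet_iff.1 hz
    exact (hf.exists_eq_toZFSet o ho).imp fun l hl => hl q

theorem closedUnderSeq (hf : IsHull κ f) (q : Q) :
    ClosedUnderSeq κ (ZFSet.range fun k => (f k q).1) := by
  intro o ho F hF
  obtain ⟨s, hs, rfl⟩ := exists_eq_sequence_of_isFunc hF
  choose k hk using fun i => ZFSet.mem_range.1 (hs i)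
  obtain rfl : (fun i => (f (k i) q).1) = s := funext hk
  exact ZFSet.mem_range.2 ((hf.exists_eq_sequence o ho k).imp fun l hl => hl q)

end IsHull

namespace IsNormalMeasure

variable {κ θ : Cardinal.{u}} {U : Ultrafilter κ.ord.ToType} {Q : Type v}
  {f : κ.ord.ToType → Q → H θ}

theorem eventually_isSkolemClosed (hU : IsNormalMeasure U) (hκ : ℵ₀ < κ)
    (hf : IsSkolemClosed setLang f) :
    ∀ᶠ a : κ.ord.ToType in U, IsSkolemClosed setLang fun k : Iio a => f k := by
  have := hU.toCardinalInterFilter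
  have := CardinalInterFilter.toCountableInterFilter (U : Filter κ.ord.ToType) hκ
  simp only [IsSkolemClosed, eventually_countable_forall]
  intro m n φ
  filter_upwards [hU.eventually_forall_tuple_exists_lt (A := ULift (Fin m ⊕ Fin n))
    ((lt_aleph0_of_finite _).trans hκ)
    fun s => hf m n φ (fun j => s ⟨.inl j⟩) fun j => s ⟨.inr j⟩] with a ha s t
  obtain ⟨k, hka, hk⟩ := ha (fun j => j.down.elim (fun j => s j) fun j => t j)
    (by rintro ⟨j | j⟩; exacts [(s j).2, (t j).2])
  exact ⟨⟨k, hka⟩, hk⟩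

theorem eventually_isHull (hU : IsNormalMeasure U) (hκ : ℵ₀ < κ) (hf : IsHull κ f) :
    ∀ᶠ a : κ.ord.ToType in U, (#(Iio a)).ord = a.toOrd →
      IsHull #(Iio a) fun k : Iio a => f k := by
  have hord : ∀ᶠ a : κ.ord.ToType in U, ∀ c < a, ∃ k < a, ∀ q, (f k q).1 = c.toOrd.1.toZFSet :=
    hU.eventually_forall_lt_exists_lt hκ.le fun c => hf.exists_eq_toZFSet _ c.toOrd.2
  have hseq : ∀ᶠ a : κ.ord.ToType in U, ∀ c < a, ∀ s : c.toOrd.1.ToType → κ.ord.ToType,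
      (∀ i, s i < a) → ∃ k < a, ∀ q, (f k q).1 = sequence fun i => (f (s i) q).1 :=
    hU.eventually_forall_lt hκ.le fun c => hU.eventually_forall_tuple_exists_lt
      (by simpa using lt_ord.1 c.toOrd.2) fun s => hf.exists_eq_sequence _ c.toOrd.2 s
  filter_upwards [hU.eventually_isSkolemClosed hκ hf.isSkolemClosed, hord, hseq]
    with a hsk hord hseq ha
  have hlt {o : Ordinal.{u}} (ho : o < (#(Iio a)).ord) : ∃ c < a, c.toOrd.1 = o := by
    rw [ha] at ho
    exact ⟨.mk ⟨o, ho.trans a.toOrd.2⟩, Ordinal.ToType.mk.lt_symm_apply.1 ho, by simp⟩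
  refine ⟨hsk, fun o ho => ?_, fun o ho s => ?_⟩
  · obtain ⟨c, hc, rfl⟩ := hlt ho
    obtain ⟨k, hka, hk⟩ := hord c hc
    exact ⟨⟨k, hka⟩, hk⟩
  · obtain ⟨c, hc, rfl⟩ := hlt ho
    obtain ⟨k, hka, hk⟩ := hseq c hc (fun i => s i) fun i => (s i).2
    exact ⟨⟨k, hka⟩, hk⟩

theorem eventually_mem_toZFSet_iff (hU : IsNormalMeasure U) (h : κ.ord.ToType → ZFSet.{u}) :
    (∀ᶠ y : κ.ord.ToType in U, h y ∈ y.toOrd.1.toZFSet) ↔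
      ∃ x ∈ κ.ord.toZFSet, ∀ᶠ y in U, h y = x := by
  refine ⟨fun hy => ?_, fun ⟨x, hx, hy⟩ => ?_⟩
  · have hlt (y : κ.ord.ToType) (hy : h y ∈ y.toOrd.1.toZFSet) :
        ∃ c < y, h y = c.toOrd.1.toZFSet := by
      obtain ⟨o, ho, hoy⟩ := Ordinal.mem_toZFSet_iff.1 hy
      exact ⟨.mk ⟨o, ho.trans y.toOrd.2⟩, Ordinal.ToType.mk.lt_symm_apply.1 ho, by simp [hoy]⟩
    have : Nonempty κ.ord.ToType := hy.exists.nonempty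
    choose! r hr hhr using hlt
    obtain ⟨c, hc⟩ := hU.exists_eventually_eq r (hy.mono hr)
    refine ⟨c.toOrd.1.toZFSet, Ordinal.mem_toZFSet_iff.2 ⟨_, c.toOrd.2, rfl⟩, ?_⟩
    filter_upwards [hy, hc] with y hy hcy using hcy ▸ hhr y hy
  · obtain ⟨o, ho, rfl⟩ := Ordinal.mem_toZFSet_iff.1 hx
    filter_upwards [hy, hU.eventually_gt_ordinal ho] with y hy hoy
    exact hy ▸ Ordinal.mem_toZFSet_iff.2 ⟨o, hoy, rfl⟩

/-! ### Ramsey systems from a normal measure -/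

theorem isRamseySystem_of_isHull (hU : IsNormalMeasure U)
    {f : κ.ord.ToType → Option κ.ord.ToType → H θ} (hf : IsHull κ f) {top : κ.ord.ToType}
    {J T : κ.ord.ToType → κ.ord.ToType}
    (htop : (f top none).1 = κ.ord.toZFSet) (htop' : ∀ y, (f top (some y)).1 = y.toOrd.1.toZFSet)
    (hJ : ∀ k y, f (J k) y = f k none)
    (hT : ∀ k, (f (T k) none).1 =
      κ.ord.toZFSet.sep fun x => ∀ᶠ y in U, x ∈ (f k (some y)).1) :
    IsRamseySystem κ U (fun k => f k none) (fun k y => f k (some y)) J top where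
  skolem_left := hf.isSkolemClosed.comp fun _ => none
  skolem_right := hf.isSkolemClosed.comp some
  realize_iff n φ s := by simp only [hJ, eventually_const]; rfl
  card_le := (mk_ord_toType κ).le
  succ_subset := hf.succ_subset htop
  closedUnderSeq := hf.closedUnderSeq none
  image_eq k _ := .of_forall fun y => hJ k _
  mem_top_iff l := by
    simpa only [htop'] using hU.eventually_mem_toZFSet_iff fun y => (f l (some y)).1
  top_mem_image k hk := .of_forall fun y => by
    rw [hJ, htop', hk]
    exact Ordinal.mem_toZFSet_iff.2 ⟨_, y.toOrd.2, rfl⟩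
  exists_trace k := ⟨T k, fun x => by rw [hT, ZFSet.mem_sep]⟩

theorem hasRamseyModel (hU : IsNormalMeasure U) (hκ : κ.IsInaccessible) (hθ : θ.IsRegular)
    (hκθ : κ < θ) {A : ZFSet.{u}} (hA : A ⊆ κ.ord.toZFSet) : HasRamseyModel κ θ A := by
  have hord : κ.ord.toZFSet ∈ H θ := toZFSet_mem_H (by simpa using hκθ)
  have htop (q : Option κ.ord.ToType) :
      (q.elim κ.ord.toZFSet fun y => y.toOrd.1.toZFSet) ∈ H θ := by
    cases q with
    | none => exact hord
    | some y => exact toZFSet_mem_H ((lt_ord.1 y.toOrd.2).trans hκθ)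
  obtain ⟨f, hf, hop⟩ := exists_isHull hκ hθ hκθ.le
    (mk_le_aleph0.trans hκ.aleph0_lt.le : #(ULift.{u} (Fin 4)) ≤ κ) fun o h q => (![
    ⟨_, htop q⟩,
    ⟨A, mem_H_of_subset hord hA⟩,
    h none,
    ⟨κ.ord.toZFSet.sep fun x => ∀ᶠ y in U, x ∈ (h (some y)).1,
      mem_H_of_subset hord ZFSet.sep_subset⟩] : Fin 4 → H θ) o.down
  have : Nonempty κ.ord.ToType := mk_ne_zero_iff.1 (by simpa using hκ.ne_zero)
  obtain ⟨top, htop⟩ := hop ⟨0⟩ (Classical.arbitrary _)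
  obtain ⟨param, hparam⟩ := hop ⟨1⟩ (Classical.arbitrary _)
  choose J hJ using hop ⟨2⟩
  choose T hT using hop ⟨3⟩
  have := hU.toCardinalInterFilter
  have h := (hU.isRamseySystem_of_isHull hf (congrArg Subtype.val (congrFun htop none))
    (fun y => congrArg Subtype.val (congrFun htop (some y))) (fun k => congrFun (hJ k))
    fun k => congrArg Subtype.val (congrFun (hT k) none)).hasRamseyModel
      hκ.aleph0_lt hθ (hκ.aleph0_lt.trans hκθ) param
  rwa [hparam] at h

theorem eventually_realize_iff (hU : IsNormalMeasure U) (hκ : ℵ₀ < κ)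
    (f : κ.ord.ToType → κ.ord.ToType → H θ) :
    ∀ᶠ a in U, ∀ n (φ : setLang.Formula (Fin n)) (s : Fin n → κ.ord.ToType), (∀ i, s i < a) →
      (φ.Realize (fun i => f (s i) a) ↔ ∀ᶠ y in U, φ.Realize fun i => f (s i) y) := by
  have := hU.toCardinalInterFilter
  have := CardinalInterFilter.toCountableInterFilter (U : Filter κ.ord.ToType) hκ
  simp only [eventually_countable_forall]
  intro n φ
  filter_upwards [hU.eventually_forall_tuple (A := ULift (Fin n))
    ((lt_aleph0_of_finite _).trans hκ) fun s => eventually_iff_eventually U fun a =>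
      φ.Realize fun i => f (s ⟨i⟩) a] with a ha s hs
  exact ha (fun i => s i.down) fun i => hs _

theorem eventually_forall_lt_eventually_eq (hU : IsNormalMeasure U) (hκ : ℵ₀ ≤ κ)
    (f : κ.ord.ToType → κ.ord.ToType → H θ) :
    ∀ᶠ a : κ.ord.ToType in U, ∀ k < a, (f k a).1 ∈ a.toOrd.1.toZFSet →
      ∀ᶠ y in U, f k y = f k a := by
  refine hU.eventually_forall_lt hκ fun k => ?_
  by_cases hk : ∀ᶠ y : κ.ord.ToType in U, (f k y).1 ∈ y.toOrd.1.toZFSet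
  · obtain ⟨x, -, hx⟩ := (hU.eventually_mem_toZFSet_iff fun y => (f k y).1).1 hk
    filter_upwards [hx] with a ha _
    exact hx.mono fun y hy => Subtype.ext (hy.trans ha.symm)
  · exact (Ultrafilter.eventually_not.2 hk).mono fun a ha hka => (ha hka).elim

theorem eventually_forall_lt_eventually_mem (hU : IsNormalMeasure U) (hκ : ℵ₀ ≤ κ)
    (f : κ.ord.ToType → κ.ord.ToType → H θ) :
    ∀ᶠ a : κ.ord.ToType in U, ∀ k < a, (f k a).1 = a.toOrd.1.toZFSet →
      ∀ᶠ y in U, a.toOrd.1.toZFSet ∈ (f k y).1 := by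
  refine hU.eventually_forall_lt hκ fun k => ?_
  filter_upwards [eventually_iff_eventually U fun a => (f k a).1 = a.toOrd.1.toZFSet] with a ha hka
  filter_upwards [ha.1 hka, hU.eventually_gt a] with y hy hay
  exact hy ▸ Ordinal.mem_toZFSet_iff.2 ⟨_, Ordinal.ToType.mk.symm.lt_iff_lt.2 hay, rfl⟩

theorem eventually_isRamseySystem_of_isHull (hU : IsNormalMeasure U) (hκ : κ.IsRegular)
    (hκ' : ℵ₀ < κ) {f : κ.ord.ToType → κ.ord.ToType × κ.ord.ToType → H θ} (hf : IsHull κ f)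
    {top : κ.ord.ToType} {J T : κ.ord.ToType → κ.ord.ToType}
    (htop : ∀ x y, (f top (x, y)).1 = x.toOrd.1.toZFSet) (hJ : ∀ k x y, f (J k) (x, y) = f k (y, y))
    (hT : ∀ k x y, (f (T k) (x, y)).1 =
      x.toOrd.1.toZFSet.sep fun z => ∀ᶠ y in U, z ∈ (f k (x, y)).1) :
    ∀ᶠ a : κ.ord.ToType in U, ∃ (J' : Iio a → Iio a) (top' : Iio a), IsRamseySystem #(Iio a) U
      (fun k : Iio a => f k (a, a)) (fun k y => f k (a, y)) J' top' := by
  have := hU.toCardinalInterFilter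
  filter_upwards [hU.eventually_isRegular hκ hκ', hU.eventually_isHull hκ' hf, hU.eventually_gt top,
    hU.eventually_forall_lt hκ'.le fun k => hU.eventually_gt (J k),
    hU.eventually_forall_lt hκ'.le fun k => hU.eventually_gt (T k),
    hU.eventually_realize_iff hκ' fun k y => f k (y, y),
    hU.eventually_forall_lt_eventually_eq hκ'.le fun k y => f k (y, y),
    hU.eventually_forall_lt_eventually_mem hκ'.le fun k y => f k (y, y)]
    with a ⟨_, hord⟩ hfa htop_lt hJ_lt hT_lt hreal himage hmem
  have hfa := hfa hord
  refine ⟨fun k => ⟨J k, hJ_lt k k.2⟩, ⟨top, htop_lt⟩, ⟨hfa.isSkolemClosed.comp fun _ => (a, a),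
    hfa.isSkolemClosed.comp fun y => (a, y), fun n φ s => ?_, le_rfl,
    hfa.succ_subset (k := ⟨top, htop_lt⟩) (by rw [htop, hord]), hfa.closedUnderSeq (a, a),
    fun k hk => ?_, fun l => ?_, fun k hk => ?_, fun k => ⟨⟨T k, hT_lt k k.2⟩, fun x => ?_⟩⟩⟩
  · simpa only [Function.comp_def, hJ] using hreal n φ (fun i => s i) fun i => (s i).2
  · simpa only [hJ] using himage k k.2 (hord ▸ hk)
  · simpa only [htop, hord] using
      eventually_mem_iff_exists_eventually_eq (card_lt_of_mem_toZFSet_ord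
        (Ordinal.mem_toZFSet_iff.2 ⟨_, a.toOrd.2, rfl⟩)) fun y => (f l (a, y)).1
  · simpa only [hJ, htop] using hmem k k.2 (hord ▸ hk)
  · rw [hT, ZFSet.mem_sep, hord]

theorem eventually_hasRamseyModel (hU : IsNormalMeasure U) (hκ : κ.IsInaccessible)
    (hθ : θ.IsRegular) (hκθ : κ ≤ θ) :
    ∀ᶠ a : κ.ord.ToType in U, ∀ A ⊆ a.toOrd.1.toZFSet, HasRamseyModel #(Iio a) θ A := by
  have hord (a : κ.ord.ToType) : a.toOrd.1.toZFSet ∈ H θ :=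
    toZFSet_mem_H ((lt_ord.1 a.toOrd.2).trans_le hκθ)
  -- If some subset of `a` has no model then `A a` is such a subset, so that the single function `A`
  -- takes care of all subsets of almost all `a`.
  have hcounterexample (a : κ.ord.ToType) : ∃ A ⊆ a.toOrd.1.toZFSet,
      HasRamseyModel #(Iio a) θ A → ∀ B ⊆ a.toOrd.1.toZFSet, HasRamseyModel #(Iio a) θ B := by
    by_contra! h
    obtain ⟨-, B, hB, hB'⟩ := h ∅ (ZFSet.empty_subset _)
    exact hB' (h B hB).1
  choose A hA hA' using hcounterexample
  obtain ⟨f, hf, hop⟩ := exists_isHull hκ hθ hκθ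
    (mk_le_aleph0.trans hκ.aleph0_lt.le : #(ULift.{u} (Fin 4)) ≤ κ)
    fun o h (q : κ.ord.ToType × κ.ord.ToType) => (![
    ⟨_, hord q.1⟩,
    ⟨A q.1, mem_H_of_subset (hord q.1) (hA q.1)⟩,
    h (q.2, q.2),
    ⟨q.1.toOrd.1.toZFSet.sep fun z => ∀ᶠ y in U, z ∈ (h (q.1, y)).1,
      mem_H_of_subset (hord q.1) ZFSet.sep_subset⟩] : Fin 4 → H θ) o.down
  have : Nonempty κ.ord.ToType := mk_ne_zero_iff.1 (by simpa using hκ.ne_zero)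
  obtain ⟨top, htop⟩ := hop ⟨0⟩ (Classical.arbitrary _)
  obtain ⟨param, hparam⟩ := hop ⟨1⟩ (Classical.arbitrary _)
  choose J hJ using hop ⟨2⟩
  choose T hT using hop ⟨3⟩
  have := hU.toCardinalInterFilter
  filter_upwards [hU.eventually_isRegular hκ.isRegular hκ.aleph0_lt, hU.eventually_gt param,
    hU.eventually_gt_ordinal (ord_lt_ord.2 hκ.aleph0_lt),
    hU.eventually_isRamseySystem_of_isHull hκ.isRegular hκ.aleph0_lt hf
      (fun x y => congrArg Subtype.val (congrFun htop (x, y)))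
      (fun k x y => congrFun (hJ k) (x, y))
      fun k x y => congrArg Subtype.val (congrFun (hT k) (x, y))]
    with a ⟨_, ha⟩ hparam_lt hω ⟨J', top', hsys⟩
  have := CardinalInterFilter.of_cardinalInterFilter_of_lt (U : Filter κ.ord.ToType)
    (mk_Iio_toType_lt a)
  refine hA' a ?_
  have h := hsys.hasRamseyModel (ord_lt_ord.1 (ha ▸ hω)) hθ (hκ.aleph0_lt.trans_le hκθ)
    ⟨param, hparam_lt⟩
  rwa [hparam] at h

end IsNormalMeasure

/-! ### Measurable cardinals -/

theorem exists_isRegular_gt (μ : Cardinal.{u}) : ∃ θ, μ < θ ∧ θ.IsRegular :=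
  ⟨Order.succ (max ℵ₀ μ), (le_max_right _ _).trans_lt (Order.lt_succ _),
    isRegular_succ (le_max_left _ _)⟩

theorem isRamsey_self_iff {κ : Cardinal.{u}} (hκ : κ.IsRegular) : IsRamsey κ κ ↔
    ∀ μ : Cardinal.{u}, ∃ θ, μ ≤ θ ∧ θ.IsRegular ∧ ∀ A ⊆ κ.ord.toZFSet, HasRamseyModel κ θ A :=
  ⟨fun h => h.2.2.2, fun h => ⟨le_rfl, hκ, hκ, h⟩⟩

theorem exists_forall_isRamsey_of_hasRamseyModel {α : Cardinal.{u}} (hα : α.IsRegular) :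
    ∃ μ : Cardinal.{u}, ∀ θ, μ ≤ θ → θ.IsRegular →
      (∀ A ⊆ α.ord.toZFSet, HasRamseyModel α θ A) → IsRamsey α α := by
  by_contra! h
  obtain ⟨-, -, -, -, hα'⟩ := h 0
  exact hα' ((isRamsey_self_iff hα).2 fun μ =>
    let ⟨θ, hμθ, hθ, hA, _⟩ := h μ
    ⟨θ, hμθ, hθ, hA⟩)

namespace IsMeasurable

variable {κ : Cardinal.{u}}

theorem isInaccessible (hκ : IsMeasurable κ) : κ.IsInaccessible :=
  let ⟨hω, _, hU, _⟩ := hκ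
  isInaccessible_of_nonprincipal hω hU

theorem exists_isNormalMeasure (hκ : IsMeasurable κ) :
    ∃ U : Ultrafilter κ.ord.ToType, IsNormalMeasure U :=
  let ⟨hω, _, hU, _⟩ := hκ
  LargeCardinal.exists_isNormalMeasure hω hU

theorem isRamsey (hκ : IsMeasurable κ) : IsRamsey κ κ := by
  obtain ⟨U, hU⟩ := hκ.exists_isNormalMeasure
  refine (isRamsey_self_iff hκ.isInaccessible.isRegular).2 fun μ => ?_
  obtain ⟨θ, hlt, hθ⟩ := exists_isRegular_gt (max κ μ)
  obtain ⟨hκθ, hμθ⟩ := max_lt_iff.1 hlt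
  exact ⟨θ, hμθ.le, hθ, fun A hA => hU.hasRamseyModel hκ.isInaccessible hθ hκθ hA⟩

theorem exists_isRamsey_lt (hκ : IsMeasurable κ) {β : Cardinal.{u}} (hβ : β < κ) :
    ∃ α : Cardinal.{u}, β < α ∧ α < κ ∧ α.IsRegular ∧ IsRamsey α α := by
  obtain ⟨U, hU⟩ := hκ.exists_isNormalMeasure
  choose! μ hμ using fun α : Cardinal.{u} => exists_forall_isRamsey_of_hasRamseyModel (α := α)
  obtain ⟨θ, hlt, hθ⟩ := exists_isRegular_gt (max κ (⨆ a : κ.ord.ToType, μ #(Iio a)))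
  obtain ⟨hκθ, hμθ⟩ := max_lt_iff.1 hlt
  have hreg := hU.eventually_isRegular hκ.isInaccessible.isRegular hκ.1
  obtain ⟨a, ⟨hreg, hord⟩, hβa, hA⟩ :=
    (hreg.and ((hU.eventually_gt_ordinal (ord_lt_ord.2 hβ)).and
      (hU.eventually_hasRamseyModel hκ.isInaccessible hθ hκθ.le))).exists
  rw [← hord] at hβa hA
  exact ⟨_, ord_lt_ord.1 hβa, mk_Iio_toType_lt a, hreg,
    hμ _ hreg θ ((le_ciSup bddAbove_of_small a).trans hμθ.le) hθ hA⟩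

end IsMeasurable

end LargeCardinal

theorem mainTheorem11 (κ : Cardinal.{u}) (hκ : LargeCardinal.IsMeasurable κ) :
    (∀ β : Cardinal.{u}, β < κ → ∃ α : Cardinal.{u}, β < α ∧ α < κ ∧ α.IsRegular ∧
      LargeCardinal.IsRamsey α α) ∧
    LargeCardinal.IsRamsey κ κ ∧
    ∃ α : Cardinal.{u}, α < κ ∧ α.IsRegular ∧ LargeCardinal.IsRamsey α α ∧
      ¬ LargeCardinal.IsMeasurable α := by
  refine ⟨fun β hβ => hκ.exists_isRamsey_lt hβ, hκ.isRamsey, ?_⟩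
  obtain ⟨μ, hμ, hmin⟩ := (Cardinal.lt_wf).has_min {μ | LargeCardinal.IsMeasurable μ} ⟨κ, hκ⟩
  obtain ⟨α, -, hα, hreg, hram⟩ := hμ.exists_isRamsey_lt (Cardinal.aleph0_pos.trans hμ.1)
  exact ⟨α, hα.trans_le (not_lt.1 (hmin κ hκ)), hreg, hram, fun h => hmin α h hα⟩
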